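/- Let $n\ge 0$ be an integer, let $p_1,\dots,p_n$ be positive integers, let $p>0$ be a real number, and let $$\Omega=\{z\in\mathbb C^{n+1}: |z_1|^{2/p_1}+\dots+|z_n|^{2/p_n}+|z_{n+1}|^{2/p}<1\}.$$ The Bergman kernel of $\Omega$ is the reproducing kernel of the space $A^2(\Omega)$ of holomorphic functions on $\Omega$ that are square-integrable for Lebesgue measure: a function $K$ on $\Omega\times\Omega$ such that, for every $z\in\Omega$, $\overline{K(z,\cdot)}\in A^2(\Omega)$ and $f(z)=\int_\Omega f(w)K(z,w)\,dV_w$ for all $f\in A^2(\Omega)$. The Bergman kernel $K$ of $\Omega$ exists and is given by the following formula. For each $k$ let $\omega_k$ be a primitive $p_k$-th root of unity. Let $z,w\in\mathbb C^{n+1}$ be such that $(z_1^{p_1},\dots,z_n^{p_n},z_{n+1})\in\Omega$ and $(w_1^{p_1},\dots,w_n^{p_n},w_{n+1})\in\Omega$, and such that $z_k\bar w_k\ne 0$ for every $k\le n$ with $p_k\ge 2$. Then $$K(z_1^{p_1},\dots,z_n^{p_n},z_{n+1},w_1^{p_1},\dots,w_n^{p_n},w_{n+1})=\frac{1}{p\,\pi^{n+1}}\prod_{k=1}^n\frac{1}{p_k^2(z_k\bar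 w_k)^{p_k-1}}\sum_{j_1=1}^{p_1}\cdots\sum_{j_n=1}^{p_n}\left.\frac{\partial^{n+1}}{\partial t^{n+1}}\left(\frac{\bar\omega_1^{j_1}\cdots\bar\omega_n^{j_n}}{(1-t)^p-z_{n+1}\bar w_{n+1}}\right)\right|_{t=\sum_{\ell=1}^n z_\ell\bar w_\ell\bar\omega_\ell^{j_\ell}},$$ where $t$ is a complex variable, $(1-t)^p$ is the principal branch, and $(z_k\bar w_k)^0=1$. -/

import Mathlib

open MeasureTheory
open scoped ComplexConjugate

/-- The Bergman space of `Ω ⊆ ℂ^ι`: functions holomorphic on `Ω` and square-integrable on `Ω` for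
Lebesgue measure. Values outside `Ω` play no role. -/
def IsBergmanFunction {ι : Type*} [Fintype ι] (Ω : Set (ι → ℂ)) (f : (ι → ℂ) → ℂ) : Prop :=
  DifferentiableOn ℂ f Ω ∧ MemLp f 2 (volume.restrict Ω)

/-- `K` is the Bergman kernel function of the domain `Ω`, i.e. the reproducing kernel of the space
of square-integrable holomorphic functions on `Ω`: for each `z ∈ Ω` the function
`w ↦ conj (K z w)` belongs to that space, and `f z = ∫_Ω f w * K z w dV_w` for all `f` in the space.
These two properties determine `K` on `Ω × Ω`. -/
structure IsBergmanKernel {ι : Type*} [Fintype ι] (Ω : Set (ι → ℂ))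
    (K : (ι → ℂ) → (ι → ℂ) → ℂ) : Prop where
  mem : ∀ z ∈ Ω, IsBergmanFunction Ω (fun w => conj (K z w))
  reproducing : ∀ f : (ι → ℂ) → ℂ, IsBergmanFunction Ω f →
    ∀ z ∈ Ω, f z = ∫ w in Ω, f w * K z w

/-- The domain `|z₁|^{2/p₁} + ⋯ + |z_n|^{2/p_n} + |z_{n+1}|^{2/r} < 1` in `ℂ^{n+1}`. -/
def generalDomain {n : ℕ} (p : Fin n → ℕ) (r : ℝ) : Set (Fin (n + 1) → ℂ) :=
  {z | (∑ k : Fin n, ‖z k.castSucc‖ ^ (2 / (p k : ℝ))) + ‖z (Fin.last n)‖ ^ (2 / r) < 1}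

/-- The point `(z₁^{p₁}, …, z_n^{p_n}, z_{n+1})`. -/
def foldPoint {n : ℕ} (p : Fin n → ℕ) (z : Fin (n + 1) → ℂ) : Fin (n + 1) → ℂ :=
  Fin.snoc (α := fun _ => ℂ) (fun k : Fin n => z k.castSucc ^ p k) (z (Fin.last n))

/-! The domain is the power ellipsoid ∑ |z_k|^{2/q_k} < 1 with q = (p_1, …, p_n, r). Rotating a
single coordinate preserves it, so distinct monomials are orthogonal
(`setIntegral_monomial_mul_conj_of_ne`); their norms are quotients of Gamma values
(`lintegral_norm_pow_powerEllipsoid`). The candidate kernel is ∑ z^α w̄^α / ‖w^α‖², and a bound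
geometric in α makes it converge (`exists_norm_kernelTerm_le`). Reproduction is checked degree by
degree: the terms with |α| = m reproduce the m-homogeneous Taylor part of f
(`sum_setIntegral_mul_kernelTerm`), and these parts sum to f (`hasSum_taylor_smul`). Uniqueness is
`IsBergmanKernel.eq_of_mem`.

For the closed form, split the multi-index as (α, β) and put u_k = z_k w̄_k for k ≤ n, v = z_{n+1}
w̄_{n+1}. Because p_k is an integer, Γ(p_k(α_k+1)) is a factorial. After u_k^{p_k-1} is factored
out, the sum over α is the part of ∑_γ Γ(a+|γ|)/Γ(a) ∏ u_k^{γ_k}/γ_k! = (1-∑u_k)^{-a} in which p_k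
divides γ_k+1 for every k, with a = r(β+1)+n+1. Averaging over roots of unity selects exactly this
part (`sum_prod_root_mul_sum_pow`). Finally Γ(a)/Γ(r(β+1)) (1-t)^{-a} is the (n+1)-st derivative of
(1-t)^{-r(β+1)}, and ∑_β v^β (1-t)^{-r(β+1)} is a geometric series with sum 1/((1-t)^r - v)
(`hasSum_iteratedDeriv_inv_sub`). -/

/-! ### Smoothness and Taylor coefficients of holomorphic functions of several variables. -/

/-- Cauchy's formula on the complex line x + ζe turns the directional derivative into a circle
integral with x as a parameter, which can be differentiated under the integral sign. -/
theorem differentiableOn_fderiv_apply {E : Type*} [NormedAddCommGroup E] [NormedSpace ℂ E]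
    [FiniteDimensional ℂ E] {f : E → ℂ} {s : Set E} (hs : IsOpen s)
    (hf : DifferentiableOn ℂ f s) (e : E) :
    DifferentiableOn ℂ (fun x => fderiv ℂ f x e) s := by
  intro x₀ hx₀
  apply DifferentiableAt.differentiableWithinAt
  borelize E
  obtain ⟨R, hR, hRs, hRf⟩ : ∃ R > 0, Metric.ball x₀ R ⊆ s ∧
      ∀ x ∈ Metric.ball x₀ R, dist (f x) (f x₀) < 1 := by
    have h1 : ∀ᶠ x in nhds x₀, x ∈ s ∧ dist (f x) (f x₀) < 1 :=
      Filter.Eventually.and (hs.mem_nhds hx₀)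
        ((hf.continuousOn.continuousAt (hs.mem_nhds hx₀)).eventually
          (Metric.ball_mem_nhds (f x₀) one_pos))
    obtain ⟨R, hR, h⟩ := Metric.eventually_nhds_iff_ball.1 h1
    exact ⟨R, hR, fun x hx => (h x hx).1, fun x hx => (h x hx).2⟩
  have hdiff : ∀ y ∈ Metric.ball x₀ R, DifferentiableAt ℂ f y := fun y hy =>
    hf.differentiableAt (hs.mem_nhds (hRs hy))
  -- Values of `f` on the big ball are within 1 of `f x₀`, hence within 2 of `f y`; this is the 2 in
  -- the Cauchy estimate.
  have hbound : ∀ y ∈ Metric.ball x₀ (R / 2), ‖fderiv ℂ f y‖ ≤ 2 / (R / 2) := by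
    intro y hy
    have hsub : Metric.ball y (R / 2) ⊆ Metric.ball x₀ R := by
      apply Metric.ball_subset_ball'
      rw [Metric.mem_ball] at hy
      linarith
    apply Complex.norm_fderiv_le_div_of_mapsTo_ball (hf.mono (hsub.trans hRs)) _ (by positivity)
    intro w hw
    have h1 := hRf w (hsub hw)
    have h2 := hRf y (hsub (Metric.mem_ball_self (by positivity)))
    rw [Metric.mem_closedBall]
    linarith [dist_triangle_right (f w) (f y) (f x₀)]
  -- The circle moves points by less than R/4; the added 1 covers e = 0.
  set ρ : ℝ := R / (4 * (‖e‖ + 1)) with hρ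
  have hρ0 : 0 < ρ := by positivity
  have hρe : ρ * ‖e‖ < R / 4 := by
    rw [hρ, div_mul_eq_mul_div, div_lt_div_iff₀ (by positivity) (by positivity)]
    nlinarith [norm_nonneg e]
  have hmem : ∀ x ∈ Metric.ball x₀ (R / 4), ∀ ζ ∈ Metric.closedBall (0 : ℂ) ρ,
      x + ζ • e ∈ Metric.ball x₀ (R / 2) := by
    intro x hx ζ hζ
    rw [mem_ball_iff_norm] at hx ⊢
    rw [mem_closedBall_zero_iff] at hζ
    calc ‖x + ζ • e - x₀‖ = ‖(x - x₀) + ζ • e‖ := by congr 1; abel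
      _ ≤ ‖x - x₀‖ + ‖ζ‖ * ‖e‖ := by rw [← norm_smul]; exact norm_add_le _ _
      _ ≤ ‖x - x₀‖ + ρ * ‖e‖ := by gcongr
      _ < R / 2 := by linarith
  have hhalf : Metric.ball x₀ (R / 2) ⊆ Metric.ball x₀ R :=
    Metric.ball_subset_ball (by linarith)
  have hformula : ∀ x ∈ Metric.ball x₀ (R / 4),
      fderiv ℂ f x e = (2 * Real.pi * Complex.I)⁻¹ *
        ∮ ζ in C(0, ρ), (1 / (ζ - 0) ^ 2) • f (x + ζ • e) := by
    intro x hx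
    have hline : ∀ ζ ∈ Metric.closedBall (0 : ℂ) ρ,
        HasDerivAt (fun ζ : ℂ => f (x + ζ • e)) (fderiv ℂ f (x + ζ • e) e) ζ := by
      intro ζ hζ
      have h1 : HasDerivAt (fun ζ : ℂ => x + ζ • e) e ζ := by
        simpa using ((hasDerivAt_id ζ).smul_const e).const_add x
      exact (hdiff _ (hhalf (hmem x hx ζ hζ))).hasFDerivAt.comp_hasDerivAt ζ h1
    have h0 := (hline 0 (by simp [hρ0.le])).deriv
    rw [DifferentiableOn.deriv_eq_smul_circleIntegral hρ0
      (fun ζ hζ => (hline ζ hζ).differentiableAt.differentiableWithinAt), h0]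
    have hpi : (2 * Real.pi * Complex.I : ℂ) ≠ 0 := Complex.two_pi_I_ne_zero
    rw [zero_smul, add_zero, smul_eq_mul, inv_mul_cancel_left₀ hpi]
  have hev : (fun x => fderiv ℂ f x e) =ᶠ[nhds x₀] fun x => (2 * Real.pi * Complex.I)⁻¹ *
        ∮ ζ in C(0, ρ), (1 / (ζ - 0) ^ 2) • f (x + ζ • e) := by
    filter_upwards [Metric.ball_mem_nhds x₀ (by positivity : 0 < R / 4)] with x hx
    exact hformula x hx
  apply DifferentiableAt.congr_of_eventuallyEq _ hev
  apply DifferentiableAt.const_mul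
  set φ : ℝ → ℂ := fun θ => deriv (circleMap 0 ρ) θ * (1 / (circleMap 0 ρ θ - 0) ^ 2) with hφ
  have hne : ∀ θ, circleMap 0 ρ θ - 0 ≠ 0 := fun θ => by
    simpa using hρ0.ne'
  have hφc : Continuous φ := by
    have h1 : Continuous (deriv (circleMap 0 ρ)) := by
      rw [show deriv (circleMap 0 ρ) = fun θ => circleMap 0 ρ θ * Complex.I from
        funext fun θ => deriv_circleMap 0 ρ θ]
      fun_prop
    refine h1.mul (Continuous.div continuous_const (by fun_prop) fun θ => pow_ne_zero 2 (hne θ))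
  have hcirc : ∀ θ, circleMap 0 ρ θ ∈ Metric.closedBall (0 : ℂ) ρ := fun θ =>
    circleMap_mem_closedBall 0 hρ0.le θ
  have hcont : ∀ x ∈ Metric.ball x₀ (R / 4),
      Continuous fun θ => φ θ * f (x + circleMap 0 ρ θ • e) := by
    intro x hx
    refine hφc.mul (continuous_iff_continuousAt.2 fun θ => ?_)
    have h1 : ContinuousAt f (x + circleMap 0 ρ θ • e) :=
      (hdiff _ (hhalf (hmem x hx _ (hcirc θ)))).continuousAt
    exact ContinuousAt.comp (f := fun θ => x + circleMap 0 ρ θ • e) h1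
      (by fun_prop)
  have key := intervalIntegral.hasFDerivAt_integral_of_dominated_of_fderiv_le
    (𝕜 := ℂ) (μ := volume) (a := 0) (b := 2 * Real.pi)
    (F := fun x θ => φ θ * f (x + circleMap 0 ρ θ • e))
    (F' := fun x θ => φ θ • fderiv ℂ f (x + circleMap 0 ρ θ • e)) (x₀ := x₀)
    (bound := fun θ => ‖φ θ‖ * (2 / (R / 2)))
    (Metric.ball_mem_nhds x₀ (by positivity : 0 < R / 4))
    (by
      filter_upwards [Metric.ball_mem_nhds x₀ (by positivity : 0 < R / 4)] with x hx
      exact (hcont x hx).aestronglyMeasurable)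
    ((hcont x₀ (Metric.mem_ball_self (by positivity))).intervalIntegrable _ _)
    (by
      apply AEStronglyMeasurable.smul hφc.aestronglyMeasurable
      apply Measurable.aestronglyMeasurable
      exact (measurable_fderiv ℂ f).comp (by fun_prop : Continuous fun θ : ℝ =>
        x₀ + circleMap 0 ρ θ • e).measurable)
    (Filter.Eventually.of_forall fun θ _ x hx => by
      rw [norm_smul]
      exact mul_le_mul_of_nonneg_left (hbound _ (hmem x hx _ (hcirc θ))) (norm_nonneg _))
    ((hφc.norm.mul continuous_const).intervalIntegrable _ _)
    (Filter.Eventually.of_forall fun θ _ x hx => by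
      have h1 := (hdiff _ (hhalf (hmem x hx _ (hcirc θ)))).hasFDerivAt
      have h2 : HasFDerivAt (fun x => f (x + circleMap 0 ρ θ • e))
          (fderiv ℂ f (x + circleMap 0 ρ θ • e)) x := by
        have := HasFDerivAt.comp x (f := fun x => x + circleMap 0 ρ θ • e) h1
          ((hasFDerivAt_id x).add_const _)
        rwa [ContinuousLinearMap.comp_id] at this
      exact h2.const_mul (φ θ))
  refine key.differentiableAt.congr_of_eventuallyEq (Filter.Eventually.of_forall fun x => ?_)
  simp only [circleIntegral, smul_eq_mul, hφ, mul_assoc]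

/-- A complex differentiable function on an open subset of a finite-dimensional space is smooth. -/
theorem DifferentiableOn.contDiffOn_of_finiteDimensional {E : Type*} [NormedAddCommGroup E]
    [NormedSpace ℂ E] [FiniteDimensional ℂ E] {s : Set E} (hs : IsOpen s) (n : ℕ) :
    ∀ {f : E → ℂ}, DifferentiableOn ℂ f s → ContDiffOn ℂ n f s := by
  induction n with
  | zero => intro f hf; simpa using hf.continuousOn
  | succ n ih =>
    intro f hf
    push_cast
    rw [contDiffOn_succ_iff_fderiv_of_isOpen hs]
    refine ⟨hf, by simp, contDiffOn_clm_apply.2 fun e => ih ?_⟩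
    exact differentiableOn_fderiv_apply hs hf e

/-- The Taylor coefficients along a line through the origin of a holomorphic function on `ℂ^ι` are
homogeneous polynomials in the direction of the line. -/
theorem exists_iteratedDeriv_smul_eq_sum {ι : Type*} [Fintype ι] [DecidableEq ι]
    {s : Set (ι → ℂ)} (hs : IsOpen s) (h0 : (0 : ι → ℂ) ∈ s) {f : (ι → ℂ) → ℂ}
    (hf : DifferentiableOn ℂ f s) (m : ℕ) :
    ∃ C : (Fin m → ι) → ℂ, ∀ w : ι → ℂ,
      iteratedDeriv m (fun ζ : ℂ => f (ζ • w)) 0 = ∑ σ : Fin m → ι, C σ * ∏ i, w (σ i) := by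
  -- The coefficients are the m-th derivative at 0 on basis vectors; the formula is multilinear
  -- expansion of the direction `w`.
  refine ⟨fun σ => iteratedFDerivWithin ℂ m f s 0 (fun i => Pi.single (σ i) 1), fun w => ?_⟩
  let g : ℂ →L[ℂ] (ι → ℂ) := (ContinuousLinearMap.id ℂ ℂ).smulRight w
  have hg0 : g 0 ∈ s := by simpa using h0
  have hopen : IsOpen (g ⁻¹' s) := hs.preimage g.continuous
  have h1 := g.iteratedFDerivWithin_comp_right (hf.contDiffOn_of_finiteDimensional hs m)
    hs.uniqueDiffOn hopen.uniqueDiffOn hg0 le_rfl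
  rw [iteratedDeriv_eq_iteratedFDeriv]
  change iteratedFDeriv ℂ m (f ∘ g) 0 (fun _ => 1) = _
  rw [← iteratedFDerivWithin_of_isOpen m hopen hg0, h1]
  have hw : w = ∑ k, w k • (Pi.single k 1 : ι → ℂ) := by
    ext j
    simp [Pi.single_apply]
  simp only [ContinuousMultilinearMap.compContinuousLinearMap_apply, map_zero]
  have hg1 : g 1 = ∑ k, w k • (Pi.single k 1 : ι → ℂ) := by
    rw [← hw]; simp [g]
  simp only [hg1]
  have := (iteratedFDerivWithin ℂ m f s 0).toMultilinearMap.map_sum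
    (fun (_ : Fin m) (k : ι) => w k • (Pi.single k 1 : ι → ℂ))
  simp only [ContinuousMultilinearMap.coe_coe] at this
  rw [this]
  refine Finset.sum_congr rfl fun σ _ => ?_
  rw [(iteratedFDerivWithin ℂ m f s 0).map_smul_univ (fun i => w (σ i))
    (fun i => Pi.single (σ i) 1), smul_eq_mul, mul_comm]

/-! ### Power ellipsoids. -/

/-- The domain `∑ |z_k|^{2/q_k} < 1` in `ℂ^ι`. -/
def powerEllipsoid {ι : Type*} [Fintype ι] (q : ι → ℝ) : Set (ι → ℂ) :=
  {z | ∑ k, ‖z k‖ ^ (2 / q k) < 1}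

section powerEllipsoid

variable {ι : Type*} [Fintype ι] {q : ι → ℝ}

theorem continuous_sum_norm_rpow (hq : ∀ k, 0 < q k) :
    Continuous fun z : ι → ℂ => ∑ k, ‖z k‖ ^ (2 / q k) := by
  refine continuous_finsetSum _ fun k _ => ?_
  exact Continuous.rpow_const (by fun_prop) fun _ => Or.inr (div_pos two_pos (hq k)).le

theorem isOpen_powerEllipsoid (hq : ∀ k, 0 < q k) : IsOpen (powerEllipsoid q) :=
  isOpen_lt (continuous_sum_norm_rpow hq) continuous_const

theorem measurableSet_powerEllipsoid (hq : ∀ k, 0 < q k) : MeasurableSet (powerEllipsoid q) :=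
  (isOpen_powerEllipsoid hq).measurableSet

theorem powerEllipsoid_of_norm_le (hq : ∀ k, 0 < q k) {z w : ι → ℂ} (hz : z ∈ powerEllipsoid q)
    (h : ∀ k, ‖w k‖ ≤ ‖z k‖) : w ∈ powerEllipsoid q := by
  refine lt_of_le_of_lt (b := ∑ k, ‖z k‖ ^ (2 / q k)) (Finset.sum_le_sum fun k _ => ?_) hz
  exact Real.rpow_le_rpow (norm_nonneg _) (h k) (div_pos two_pos (hq k)).le

theorem zero_mem_powerEllipsoid (hq : ∀ k, 0 < q k) : (0 : ι → ℂ) ∈ powerEllipsoid q := by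
  have : ∀ k, (0 : ℝ) ^ (2 / q k) = 0 := fun k => Real.zero_rpow (div_pos two_pos (hq k)).ne'
  simp [powerEllipsoid, this]

theorem norm_le_one_of_sum_rpow_le_one (hq : ∀ k, 0 < q k) {z : ι → ℂ}
    (hz : ∑ k, ‖z k‖ ^ (2 / q k) ≤ 1) (k : ι) : ‖z k‖ ≤ 1 := by
  by_contra! h
  have h1 : 1 < ‖z k‖ ^ (2 / q k) := Real.one_lt_rpow h (div_pos two_pos (hq k))
  have h2 : ‖z k‖ ^ (2 / q k) ≤ ∑ k, ‖z k‖ ^ (2 / q k) :=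
    Finset.single_le_sum (f := fun k => ‖z k‖ ^ (2 / q k))
      (fun k _ => Real.rpow_nonneg (norm_nonneg _) _) (Finset.mem_univ k)
  linarith

theorem norm_le_one_of_mem_powerEllipsoid (hq : ∀ k, 0 < q k) {z : ι → ℂ}
    (hz : z ∈ powerEllipsoid q) (k : ι) : ‖z k‖ ≤ 1 :=
  norm_le_one_of_sum_rpow_le_one hq (le_of_lt hz) k

theorem powerEllipsoid_subset_closedBall (hq : ∀ k, 0 < q k) :
    powerEllipsoid q ⊆ Metric.closedBall 0 1 := fun z hz => by
  rw [mem_closedBall_zero_iff, pi_norm_le_iff_of_nonneg zero_le_one]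
  exact norm_le_one_of_mem_powerEllipsoid hq hz

theorem volume_powerEllipsoid_lt_top (hq : ∀ k, 0 < q k) : volume (powerEllipsoid q) < ⊤ :=
  (measure_mono (powerEllipsoid_subset_closedBall hq)).trans_lt measure_closedBall_lt_top

end powerEllipsoid

/-! ### Torus symmetry and orthogonality of monomials. -/

section Rotation

variable {ι : Type*} [Fintype ι] {q : ι → ℝ}

/-- Coordinatewise rotation of `ℂ^ι`. -/
noncomputable def torusRotation (c : ι → Circle) : (ι → ℂ) ≃ᵐ (ι → ℂ) :=
  MeasurableEquiv.piCongrRight fun k => (rotation (c k)).toMeasurableEquiv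

omit [Fintype ι] in
theorem torusRotation_apply (c : ι → Circle) (w : ι → ℂ) (k : ι) :
    torusRotation c w k = c k * w k := rfl

theorem measurePreserving_torusRotation (c : ι → Circle) :
    MeasurePreserving (torusRotation c) :=
  volume_preserving_pi (f := fun k => rotation (c k))
    fun k => (rotation (c k)).measurePreserving

omit [Fintype ι] in
theorem norm_torusRotation_apply (c : ι → Circle) (w : ι → ℂ) (k : ι) :
    ‖torusRotation c w k‖ = ‖w k‖ := by
  rw [torusRotation_apply, norm_mul, Circle.norm_coe, one_mul]

theorem torusRotation_mem_powerEllipsoid (c : ι → Circle) (w : ι → ℂ) :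
    torusRotation c w ∈ powerEllipsoid q ↔ w ∈ powerEllipsoid q := by
  simp only [powerEllipsoid, Set.mem_ofPred_eq, norm_torusRotation_apply]

theorem setIntegral_comp_torusRotation (c : ι → Circle) (g : (ι → ℂ) → ℂ) :
    ∫ w in powerEllipsoid q, g (torusRotation c w) = ∫ w in powerEllipsoid q, g w := by
  have h := (measurePreserving_torusRotation c).setIntegral_preimage_emb
    (torusRotation c).measurableEmbedding g (powerEllipsoid q)
  rwa [show torusRotation c ⁻¹' powerEllipsoid q = powerEllipsoid q from
    Set.ext fun w => torusRotation_mem_powerEllipsoid c w] at h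

/-- Distinct monomials are orthogonal on a power ellipsoid. -/
theorem setIntegral_monomial_mul_conj_of_ne {α β : ι → ℕ} (h : α ≠ β) :
    ∫ w in powerEllipsoid q, (∏ k, w k ^ α k) * conj (∏ k, w k ^ β k) = 0 := by
  classical
  obtain ⟨k, hk⟩ := Function.ne_iff.1 h
  set I := ∫ w in powerEllipsoid q, (∏ k, w k ^ α k) * conj (∏ k, w k ^ β k) with hI
  -- One radian is not a rational multiple of 2π, so distinct powers of `u` differ and this one
  -- rotation separates all exponents.
  let u : Circle := Circle.exp 1
  have key : ((u : ℂ) ^ α k * conj (u : ℂ) ^ β k) * I = I := by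
    have h1 := setIntegral_comp_torusRotation (q := q) (Pi.mulSingle k u)
      (fun w => (∏ k, w k ^ α k) * conj (∏ k, w k ^ β k))
    refine Eq.trans ?_ h1
    rw [hI, ← integral_const_mul]
    congr 1
    ext w
    have h2 : ∀ γ : ι → ℕ, ∏ j, (torusRotation (Pi.mulSingle k u) w j) ^ γ j =
        (u : ℂ) ^ γ k * ∏ j, w j ^ γ j := by
      intro γ
      simp only [torusRotation_apply, mul_pow, Finset.prod_mul_distrib]
      congr 1
      rw [Finset.prod_eq_single k]
      · simp
      · intro j _ hj
        simp [Pi.mulSingle_eq_of_ne hj]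
      · simp
    rw [h2, h2]
    simp only [map_mul, map_pow]
    ring
  have hne : (u : ℂ) ^ α k * conj (u : ℂ) ^ β k ≠ 1 := by
    intro h3
    have h4 : (u : ℂ) ^ α k = (u : ℂ) ^ β k := by
      have h5 : conj (u : ℂ) * u = 1 := by
        rw [mul_comm, Complex.mul_conj, Circle.normSq_coe]; simp
      calc (u : ℂ) ^ α k = (u : ℂ) ^ α k * (conj (u : ℂ) * u) ^ β k := by rw [h5]; simp
        _ = ((u : ℂ) ^ α k * conj (u : ℂ) ^ β k) * u ^ β k := by rw [mul_pow]; ring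
        _ = _ := by rw [h3, one_mul]
    have h6 : Complex.exp (((α k : ℝ) : ℂ) * Complex.I) =
        Complex.exp (((β k : ℝ) : ℂ) * Complex.I) := by
      simpa [u, Circle.coe_exp, ← Complex.exp_nat_mul] using h4
    rw [Complex.exp_eq_exp_iff_exists_int] at h6
    obtain ⟨m, hm⟩ := h6
    have h7 : ((α k : ℝ)) = β k + m * (2 * Real.pi) := by
      have := congrArg Complex.im hm
      simpa using this
    by_cases hm0 : m = 0
    · subst hm0
      apply hk
      exact_mod_cast (by simpa using h7 : (α k : ℝ) = β k)
    · apply irrational_pi.ne_rational ((α k : ℤ) - β k) (2 * m)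
      have hm' : (m : ℝ) ≠ 0 := by exact_mod_cast hm0
      push_cast
      field_simp
      linarith
  by_contra hI0
  exact hne (mul_right_cancel₀ hI0 (by rw [key, one_mul]))

end Rotation

/-! ### Norms of monomials via Gamma integrals. -/

theorem integral_norm_rpow_mul_exp_neg {p a : ℝ} (hp : 0 < p) (ha : -2 < a) :
    ∫ x : ℂ, ‖x‖ ^ a * Real.exp (-‖x‖ ^ p) =
      (2 * Real.pi / p) * Real.Gamma ((a + 2) / p) := by
  calc
    _ = ∫ x in Set.Ioi (0 : ℝ) ×ˢ Set.Ioo (-Real.pi) Real.pi,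
          x.1 * (|x.1| ^ a * Real.exp (-|x.1| ^ p)) := by
      rw [← Complex.integral_comp_polarCoord_symm, polarCoord_target]
      simp_rw [Complex.norm_polarCoord_symm, smul_eq_mul]
    _ = (∫ x in Set.Ioi (0 : ℝ), x * |x| ^ a * Real.exp (-|x| ^ p)) *
          ∫ _ in Set.Ioo (-Real.pi) Real.pi, 1 := by
      rw [← setIntegral_prod_mul, Measure.volume_eq_prod]
      simp_rw [mul_one]
      congr! 2; ring
    _ = 2 * Real.pi * ∫ x in Set.Ioi (0 : ℝ), x * |x| ^ a * Real.exp (-|x| ^ p) := by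
      simp_rw [integral_const, measureReal_restrict_apply MeasurableSet.univ, Set.univ_inter,
        Real.volume_real_Ioo_of_le (a := -Real.pi) (b := Real.pi) (by linarith [Real.pi_nonneg]),
        sub_neg_eq_add, ← two_mul, smul_eq_mul, mul_one, mul_comm]
    _ = 2 * Real.pi * ∫ x in Set.Ioi (0 : ℝ), x ^ (a + 1) * Real.exp (-x ^ p) := by
      congr 1
      refine setIntegral_congr_fun measurableSet_Ioi (fun x hx => ?_)
      rw [Set.mem_Ioi] at hx
      rw [abs_eq_self.mpr hx.le, Real.rpow_add hx, Real.rpow_one]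
      ring
    _ = (2 * Real.pi / p) * Real.Gamma ((a + 2) / p) := by
      rw [_root_.integral_rpow_mul_exp_neg_rpow hp (by linarith), add_assoc,
        one_add_one_eq_two]
      ring

theorem integral_norm_pow_mul_exp_neg {q : ℝ} (hq : 0 < q) (a : ℕ) :
    ∫ x : ℂ, ‖x‖ ^ (2 * a) * Real.exp (-‖x‖ ^ (2 / q)) =
      Real.pi * q * Real.Gamma (q * (a + 1)) := by
  have h := integral_norm_rpow_mul_exp_neg (p := 2 / q) (a := ((2 * a : ℕ) : ℝ))
    (by positivity) (by have : (0 : ℝ) ≤ ((2 * a : ℕ) : ℝ) := by positivity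
                        linarith)
  simp only [Real.rpow_natCast] at h
  rw [h]
  push_cast
  congr 1
  · field_simp
  · congr 1
    field_simp

theorem integrable_norm_pow_mul_exp_neg {q : ℝ} (hq : 0 < q) (a : ℕ) :
    Integrable fun x : ℂ => ‖x‖ ^ (2 * a) * Real.exp (-‖x‖ ^ (2 / q)) := by
  -- A non-integrable function has integral 0 by convention, so a nonzero value proves
  -- integrability.
  apply not_imp_comm.1 integral_undef
  rw [integral_norm_pow_mul_exp_neg hq a]
  exact (mul_pos (mul_pos Real.pi_pos hq) (Real.Gamma_pos_of_pos (by positivity))).ne'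

section

variable {ι : Type*} [Fintype ι] {q : ι → ℝ}

theorem lintegral_comp_smul_coord {c : ι → ℝ} (hc : ∀ k, 0 < c k) {g : (ι → ℂ) → ENNReal}
    (hg : Measurable g) :
    ∫⁻ w, g w = ENNReal.ofReal (∏ k, c k ^ 2) * ∫⁻ w : ι → ℂ, g (fun k => c k • w k) := by
  let L : (ι → ℂ) →ₗ[ℝ] (ι → ℂ) :=
    LinearMap.pi fun k => (c k • LinearMap.id (R := ℝ) (M := ℂ)).comp (LinearMap.proj k)
  have hdet : LinearMap.det L = ∏ k, c k ^ 2 := by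
    simp only [L]
    rw [LinearMap.det_pi]
    simp [LinearMap.det_smul, Complex.finrank_real_complex]
  have hprod : 0 < ∏ k, c k ^ 2 := Finset.prod_pos fun k _ => pow_pos (hc k) 2
  have h := Measure.map_linearMap_addHaar_eq_smul_addHaar (volume : Measure (ι → ℂ))
    (f := L) (by rw [hdet]; exact hprod.ne')
  have hL : Measurable L := L.continuous_of_finiteDimensional.measurable
  have h2 := lintegral_map (μ := volume) hg hL
  rw [h, lintegral_smul_measure, hdet, abs_of_pos (inv_pos.2 hprod)] at h2
  change _ = ∫⁻ w : ι → ℂ, g (fun k => c k • w k) at h2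
  rw [← h2, smul_eq_mul, ← mul_assoc, ← ENNReal.ofReal_mul hprod.le, mul_inv_cancel₀ hprod.ne']
  simp

/-- The dilation w_k ↦ t^{q_k/2} w_k maps the unit ellipsoid onto the sublevel set; it contributes
t^{q_k} from the real Jacobian and t^{q_k α_k} from the monomial. -/
theorem lintegral_sum_rpow_lt (hq : ∀ k, 0 < q k) (α : ι → ℕ) {t : ℝ} (ht : 0 < t) :
    ∫⁻ w in {w : ι → ℂ | ∑ k, ‖w k‖ ^ (2 / q k) < t}, ENNReal.ofReal (∏ k, ‖w k‖ ^ (2 * α k)) =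
      ENNReal.ofReal (t ^ (∑ k, q k * (α k + 1))) *
        ∫⁻ w in powerEllipsoid q, ENNReal.ofReal (∏ k, ‖w k‖ ^ (2 * α k)) := by
  have hmeas : ∀ s : ℝ, MeasurableSet {w : ι → ℂ | ∑ k, ‖w k‖ ^ (2 / q k) < s} := fun s =>
    (isOpen_lt (continuous_sum_norm_rpow hq) continuous_const).measurableSet
  have hc : ∀ k, 0 < t ^ (q k / 2) := fun k => Real.rpow_pos_of_pos ht _
  have hpow : Measurable fun w : ι → ℂ => ENNReal.ofReal (∏ k, ‖w k‖ ^ (2 * α k)) := by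
    fun_prop
  have hnorm : ∀ (w : ι → ℂ) k, ‖t ^ (q k / 2) • w k‖ = t ^ (q k / 2) * ‖w k‖ := fun w k => by
    rw [norm_smul, Real.norm_of_nonneg (hc k).le]
  have hsum : ∀ w : ι → ℂ, ∑ k, ‖t ^ (q k / 2) • w k‖ ^ (2 / q k) =
      t * ∑ k, ‖w k‖ ^ (2 / q k) := by
    intro w
    rw [Finset.mul_sum]
    refine Finset.sum_congr rfl fun k _ => ?_
    rw [hnorm, Real.mul_rpow (hc k).le (norm_nonneg _), ← Real.rpow_mul ht.le,
      show q k / 2 * (2 / q k) = 1 by field_simp [(hq k).ne'], Real.rpow_one]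
  have hprod : ∀ w : ι → ℂ, ∏ k, ‖t ^ (q k / 2) • w k‖ ^ (2 * α k) =
      (∏ k, t ^ (q k * α k)) * ∏ k, ‖w k‖ ^ (2 * α k) := by
    intro w
    rw [← Finset.prod_mul_distrib]
    refine Finset.prod_congr rfl fun k _ => ?_
    rw [hnorm, mul_pow, ← Real.rpow_natCast (t ^ (q k / 2)), ← Real.rpow_mul ht.le]
    congr 2
    push_cast
    ring
  have hconst : t ^ (∑ k, q k * (α k + 1)) = (∏ k, (t ^ (q k / 2)) ^ 2) * ∏ k, t ^ (q k * α k) := by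
    rw [← Finset.prod_mul_distrib, Real.rpow_sum_of_pos ht]
    refine Finset.prod_congr rfl fun k _ => ?_
    rw [← Real.rpow_natCast, ← Real.rpow_mul ht.le, ← Real.rpow_add ht]
    congr 1
    push_cast
    ring
  rw [← lintegral_indicator (hmeas t), lintegral_comp_smul_coord hc (hpow.indicator (hmeas t)),
    powerEllipsoid, ← lintegral_indicator (hmeas 1), hconst,
    ENNReal.ofReal_mul (Finset.prod_nonneg fun k _ => by positivity), mul_assoc]
  congr 1
  rw [← lintegral_const_mul _ (hpow.indicator (hmeas 1))]
  refine lintegral_congr fun w => ?_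
  by_cases hw : ∑ k, ‖w k‖ ^ (2 / q k) < 1
  · rw [Set.indicator_of_mem (show w ∈ {w : ι → ℂ | ∑ k, ‖w k‖ ^ (2 / q k) < 1} from hw),
      Set.indicator_of_mem, hprod,
      ENNReal.ofReal_mul (Finset.prod_nonneg fun k _ => Real.rpow_nonneg ht.le _)]
    change ∑ k, ‖t ^ (q k / 2) • w k‖ ^ (2 / q k) < t
    rw [hsum]
    exact mul_lt_of_lt_one_right ht hw
  · rw [Set.indicator_of_notMem
      (show w ∉ {w : ι → ℂ | ∑ k, ‖w k‖ ^ (2 / q k) < 1} from hw),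
      Set.indicator_of_notMem, mul_zero]
    change ¬ ∑ k, ‖t ^ (q k / 2) • w k‖ ^ (2 / q k) < t
    rw [hsum, not_lt]
    exact le_mul_of_one_le_right ht.le (not_lt.1 hw)

theorem lintegral_Ioi_indicator_exp_neg {s : ℝ} (hs : 0 ≤ s) :
    ∫⁻ t in Set.Ioi (0 : ℝ), (Set.Ioi s).indicator (fun t => ENNReal.ofReal (Real.exp (-t))) t =
      ENNReal.ofReal (Real.exp (-s)) := by
  rw [lintegral_indicator measurableSet_Ioi, Measure.restrict_restrict measurableSet_Ioi,
    Set.inter_eq_left.2 (Set.Ioi_subset_Ioi hs), ← integral_exp_neg_Ioi,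
    ofReal_integral_eq_lintegral_ofReal (integrableOn_exp_neg_Ioi s)]
  exact Filter.Eventually.of_forall fun t => (Real.exp_pos _).le

/-- With N(w) = ∑ |w_k|^{2/q_k}, integrate |w^α|² e^{-N(w)} over the whole space in two ways. It
factors into one-variable Gamma integrals; and writing e^{-N} as the integral of e^{-t} over t > N,
then scaling by `lintegral_sum_rpow_lt`, gives the wanted integral times Γ(1+A). -/
theorem lintegral_norm_pow_powerEllipsoid (hq : ∀ k, 0 < q k) (α : ι → ℕ) :
    ∫⁻ w in powerEllipsoid q, ENNReal.ofReal (∏ k, ‖w k‖ ^ (2 * α k)) =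
      ENNReal.ofReal ((∏ k, Real.pi * q k * Real.Gamma (q k * (α k + 1))) /
        Real.Gamma (1 + ∑ k, q k * (α k + 1))) := by
  set V := ∫⁻ w in powerEllipsoid q, ENNReal.ofReal (∏ k, ‖w k‖ ^ (2 * α k)) with hV
  set A : ℝ := ∑ k, q k * (α k + 1) with hA
  have hA0 : 0 ≤ A := Finset.sum_nonneg fun k _ => mul_nonneg (hq k).le (by positivity)
  have hG : 0 < Real.Gamma (1 + A) := Real.Gamma_pos_of_pos (by positivity)
  have hcont := continuous_sum_norm_rpow hq
  have hpow : Measurable fun w : ι → ℂ => ENNReal.ofReal (∏ k, ‖w k‖ ^ (2 * α k)) := by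
    fun_prop
  have h1 : ∫⁻ w : ι → ℂ, ENNReal.ofReal (∏ k, ‖w k‖ ^ (2 * α k)) *
      ENNReal.ofReal (Real.exp (-∑ k, ‖w k‖ ^ (2 / q k))) =
      ENNReal.ofReal (∏ k, Real.pi * q k * Real.Gamma (q k * (α k + 1))) := by
    have hint : ∀ k, Integrable fun x : ℂ =>
        ‖x‖ ^ (2 * α k) * Real.exp (-‖x‖ ^ (2 / q k)) := fun k =>
      integrable_norm_pow_mul_exp_neg (hq k) (α k)
    have hval := integral_fintype_prod_volume_eq_prod (𝕜 := ℝ)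
      (fun (k : ι) (x : ℂ) => ‖x‖ ^ (2 * α k) * Real.exp (-‖x‖ ^ (2 / q k)))
    have hint' := Integrable.fintype_prod (μ := fun _ : ι => (volume : Measure ℂ)) hint
    rw [← volume_pi] at hint'
    rw [← Finset.prod_congr rfl fun k _ => integral_norm_pow_mul_exp_neg (hq k) (α k), ← hval,
      ofReal_integral_eq_lintegral_ofReal hint'
        (Filter.Eventually.of_forall fun w => Finset.prod_nonneg fun k _ => by positivity)]
    refine lintegral_congr fun w => ?_
    rw [← ENNReal.ofReal_mul (Finset.prod_nonneg fun k _ => by positivity),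
      ← Finset.sum_neg_distrib, Real.exp_sum, Finset.prod_mul_distrib]
  have h2 : ∫⁻ w : ι → ℂ, ENNReal.ofReal (∏ k, ‖w k‖ ^ (2 * α k)) *
      ENNReal.ofReal (Real.exp (-∑ k, ‖w k‖ ^ (2 / q k))) = V * ENNReal.ofReal (Real.Gamma (1 + A)) := by
    calc _ = ∫⁻ w : ι → ℂ, ∫⁻ t in Set.Ioi (0 : ℝ), ENNReal.ofReal (∏ k, ‖w k‖ ^ (2 * α k)) *
          (Set.Ioi (∑ k, ‖w k‖ ^ (2 / q k))).indicator
            (fun t => ENNReal.ofReal (Real.exp (-t))) t := by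
          refine lintegral_congr fun w => ?_
          rw [lintegral_const_mul _ (Measurable.indicator (by fun_prop) measurableSet_Ioi),
            lintegral_Ioi_indicator_exp_neg (Finset.sum_nonneg fun k _ => by positivity)]
      _ = ∫⁻ t in Set.Ioi (0 : ℝ), ∫⁻ w : ι → ℂ, ENNReal.ofReal (∏ k, ‖w k‖ ^ (2 * α k)) *
          (Set.Ioi (∑ k, ‖w k‖ ^ (2 / q k))).indicator
            (fun t => ENNReal.ofReal (Real.exp (-t))) t := by
          apply lintegral_lintegral_swap
          apply Measurable.aemeasurable
          apply Measurable.mul (by fun_prop)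
          have hset : MeasurableSet {x : (ι → ℂ) × ℝ | ∑ k, ‖x.1 k‖ ^ (2 / q k) < x.2} :=
            measurableSet_lt (hcont.measurable.comp measurable_fst) measurable_snd
          exact Measurable.indicator (f := fun x : (ι → ℂ) × ℝ => ENNReal.ofReal (Real.exp (-x.2)))
            (by fun_prop) hset
      _ = ∫⁻ t in Set.Ioi (0 : ℝ), V * ENNReal.ofReal (Real.exp (-t) * t ^ ((1 + A) - 1)) := by
          refine setLIntegral_congr_fun measurableSet_Ioi fun t ht => ?_
          have hset : MeasurableSet {w : ι → ℂ | ∑ k, ‖w k‖ ^ (2 / q k) < t} :=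
            measurableSet_lt hcont.measurable measurable_const
          have h3 := lintegral_sum_rpow_lt hq α ht
          rw [ENNReal.ofReal_mul (Real.exp_pos _).le, add_sub_cancel_left, mul_left_comm, mul_comm V,
            ← h3, ← lintegral_indicator hset, ← lintegral_const_mul _ (hpow.indicator hset)]
          refine lintegral_congr fun w => ?_
          by_cases hw : ∑ k, ‖w k‖ ^ (2 / q k) < t
          · rw [Set.indicator_of_mem (show t ∈ Set.Ioi _ from hw),
              Set.indicator_of_mem (show w ∈ {w : ι → ℂ | ∑ k, ‖w k‖ ^ (2 / q k) < t} from hw),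
              mul_comm]
          · rw [Set.indicator_of_notMem (show t ∉ Set.Ioi _ from hw),
              Set.indicator_of_notMem (show w ∉ {w : ι → ℂ | ∑ k, ‖w k‖ ^ (2 / q k) < t} from hw),
              mul_zero, mul_zero]
      _ = V * ENNReal.ofReal (Real.Gamma (1 + A)) := by
          rw [lintegral_const_mul _ (by fun_prop), Real.Gamma_eq_integral (by positivity),
            ofReal_integral_eq_lintegral_ofReal (Real.GammaIntegral_convergent (by positivity))]
          filter_upwards [ae_restrict_mem measurableSet_Ioi] with t ht
          exact mul_nonneg (Real.exp_pos _).le (Real.rpow_nonneg (le_of_lt ht) _)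
  rw [ENNReal.ofReal_div_of_pos hG, ← h1, h2, ENNReal.mul_div_cancel_right]
  · simpa using hG
  · simp

end

/-! ### Convergence of the orthogonal expansion. -/

theorem summable_prod_pow {ι : Type*} [Fintype ι] {ρ : ℝ} (h0 : 0 ≤ ρ) (h1 : ρ < 1) :
    Summable fun α : ι → ℕ => ∏ k, ρ ^ α k := by
  classical
  refine summable_of_sum_le (c := ∏ _k : ι, (1 - ρ)⁻¹)
    (fun α => Finset.prod_nonneg fun k _ => pow_nonneg h0 _) fun S => ?_
  have hsub : S ⊆ Fintype.piFinset fun _ : ι => Finset.range (S.sup (fun α => ∑ k, α k) + 1) := by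
    intro α hα
    rw [Fintype.mem_piFinset]
    intro k
    rw [Finset.mem_range, Nat.lt_succ_iff]
    exact (Finset.single_le_sum (f := α) (fun _ _ => Nat.zero_le _) (Finset.mem_univ k)).trans
      (Finset.le_sup (f := fun α : ι → ℕ => ∑ k, α k) hα)
  refine (Finset.sum_le_sum_of_subset_of_nonneg hsub fun α _ _ =>
    Finset.prod_nonneg fun k _ => pow_nonneg h0 _).trans ?_
  rw [← Finset.prod_univ_sum]
  refine Finset.prod_le_prod (fun k _ => Finset.sum_nonneg fun _ _ => pow_nonneg h0 _)
    fun k _ => ?_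
  rw [← tsum_geometric_of_lt_one h0 h1]
  exact (summable_geometric_of_lt_one h0 h1).sum_le_tsum _ fun _ _ => pow_nonneg h0 _

section

variable {ι : Type*} [Fintype ι] {q : ι → ℝ}

/-- The squared `L²` norm of the monomial `w ^ α` on the domain `∑ |z_k|^{2/q_k} < 1`. -/
noncomputable def monomialNormSq (q : ι → ℝ) (α : ι → ℕ) : ℝ :=
  (∏ k, Real.pi * q k * Real.Gamma (q k * (α k + 1))) / Real.Gamma (1 + ∑ k, q k * (α k + 1))

theorem monomialNormSq_pos (hq : ∀ k, 0 < q k) (α : ι → ℕ) : 0 < monomialNormSq q α := by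
  have hk : ∀ k, 0 < q k * (α k + 1) := fun k => mul_pos (hq k) (by positivity)
  refine div_pos (Finset.prod_pos fun k _ => ?_) (Real.Gamma_pos_of_pos ?_)
  · exact mul_pos (mul_pos Real.pi_pos (hq k)) (Real.Gamma_pos_of_pos (hk k))
  · have := Finset.sum_nonneg fun k (_ : k ∈ Finset.univ) => (hk k).le
    linarith

theorem setIntegral_monomial_mul_conj_self (hq : ∀ k, 0 < q k) (α : ι → ℕ) :
    ∫ w in powerEllipsoid q, (∏ k, w k ^ α k) * conj (∏ k, w k ^ α k) =
      (monomialNormSq q α : ℂ) := by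
  have h1 : ∀ w : ι → ℂ, (∏ k, w k ^ α k) * conj (∏ k, w k ^ α k) =
      ((∏ k, ‖w k‖ ^ (2 * α k) : ℝ) : ℂ) := by
    intro w
    rw [Complex.mul_conj, Complex.normSq_eq_norm_sq, norm_prod, ← Finset.prod_pow]
    congr 1
    refine Finset.prod_congr rfl fun k _ => ?_
    rw [norm_pow, ← pow_mul, mul_comm]
  simp only [h1]
  rw [integral_complex_ofReal, integral_eq_lintegral_of_nonneg_ae
    (Filter.Eventually.of_forall fun w => Finset.prod_nonneg fun k _ => by positivity)
    (by
      apply Continuous.aestronglyMeasurable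
      fun_prop), lintegral_norm_pow_powerEllipsoid hq, ← monomialNormSq,
    ENNReal.toReal_ofReal (monomialNormSq_pos hq α).le]

/-- The compact sublevel set has a δ-neighbourhood inside the domain. A small polydisc there, pushed
outward from u, has |w_k| ≥ u_k + δ/2 throughout, which bounds the monomial's norm below. As u_k ≤
1, each ratio u_k/(u_k + δ/2) is at most 1/(1 + δ/2). -/
theorem exists_monomialNormSq_inv_mul_le (hq : ∀ k, 0 < q k) {s : ℝ} (hs : s < 1) :
    ∃ C ρ : ℝ, 0 ≤ ρ ∧ ρ < 1 ∧ ∀ u : ι → ℝ, (∀ k, 0 ≤ u k) → ∑ k, u k ^ (2 / q k) ≤ s →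
      ∀ α : ι → ℕ, (monomialNormSq q α)⁻¹ * ∏ k, u k ^ (2 * α k) ≤ C * ∏ k, ρ ^ α k := by
  set K : Set (ι → ℂ) := {z | ∑ k, ‖z k‖ ^ (2 / q k) ≤ s} with hK
  have hKD : K ⊆ powerEllipsoid q := fun z hz => lt_of_le_of_lt (b := s) hz hs
  have hKc : IsCompact K := by
    apply Metric.isCompact_of_isClosed_isBounded
    · exact isClosed_le (continuous_sum_norm_rpow hq) continuous_const
    · exact Metric.isBounded_closedBall.subset (hKD.trans (powerEllipsoid_subset_closedBall hq))
  obtain ⟨δ, hδ, hδD⟩ := hKc.exists_cthickening_subset_open (isOpen_powerEllipsoid hq) hKD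
  set v : ℝ := volume.real (Metric.closedBall (0 : ι → ℂ) (δ / 4)) with hv
  have hv0 : 0 < v := ENNReal.toReal_pos
    (Metric.measure_closedBall_pos volume _ (by positivity)).ne' measure_closedBall_lt_top.ne
  refine ⟨v⁻¹, (1 / (1 + δ / 2)) ^ 2, by positivity, ?_, fun u hu hus α => ?_⟩
  · apply pow_lt_one₀ (by positivity) _ two_ne_zero
    rw [div_lt_one (by positivity)]
    linarith
  have huK : (fun k => (u k : ℂ)) ∈ K := by
    change ∑ k, ‖(u k : ℂ)‖ ^ (2 / q k) ≤ s
    simpa [abs_of_nonneg, hu] using hus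
  have hu1 : ∀ k, u k ≤ 1 := by
    intro k
    have := norm_le_one_of_mem_powerEllipsoid hq (hKD huK) k
    simpa [abs_of_nonneg, hu] using this
  -- A shift of 3δ/4 with radius δ/4 stays within δ of u and keeps moduli at least u_k + δ/2.
  set c : ι → ℂ := fun k => ((u k + 3 * δ / 4 : ℝ) : ℂ) with hc
  have hball : Metric.closedBall c (δ / 4) ⊆ powerEllipsoid q := by
    refine Set.Subset.trans (fun w hw => ?_) hδD
    refine Metric.mem_cthickening_of_dist_le w _ δ K huK ?_
    have h1 : dist c (fun k => (u k : ℂ)) ≤ 3 * δ / 4 := by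
      rw [dist_pi_le_iff (by positivity)]
      intro k
      rw [hc, Complex.dist_eq, ← Complex.ofReal_sub, Complex.norm_real, add_sub_cancel_left,
        Real.norm_of_nonneg (by positivity)]
    have h2 := dist_triangle w c (fun k => (u k : ℂ))
    rw [Metric.mem_closedBall] at hw
    linarith
  have hlow : ∀ w ∈ Metric.closedBall c (δ / 4), ∀ k, u k + δ / 2 ≤ ‖w k‖ := by
    intro w hw k
    have h1 : ‖w k - c k‖ ≤ δ / 4 := by
      rw [← dist_eq_norm]
      exact (dist_le_pi_dist w c k).trans hw
    have h2 : ‖c k‖ = u k + 3 * δ / 4 := by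
      rw [hc, Complex.norm_real, Real.norm_of_nonneg (add_nonneg (hu k) (by positivity))]
    have h3 := norm_sub_norm_le (c k) (w k)
    rw [norm_sub_rev] at h3
    linarith
  set P : ℝ := ∏ k, (u k + δ / 2) ^ (2 * α k) with hP
  have hpos : ∀ k, 0 < u k + δ / 2 := fun k => add_pos_of_nonneg_of_pos (hu k) (by positivity)
  have hP0 : 0 < P := Finset.prod_pos fun k _ => pow_pos (hpos k) _
  have hle : P * v ≤ monomialNormSq q α := by
    rw [← ENNReal.ofReal_le_ofReal_iff (monomialNormSq_pos hq α).le, monomialNormSq,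
      ← lintegral_norm_pow_powerEllipsoid hq]
    calc ENNReal.ofReal (P * v)
        = ∫⁻ w in Metric.closedBall c (δ / 4), ENNReal.ofReal P := by
          rw [setLIntegral_const, ENNReal.ofReal_mul hP0.le, hv, Measure.real,
            ENNReal.ofReal_toReal measure_closedBall_lt_top.ne,
            Measure.addHaar_closedBall_center volume c]
      _ ≤ ∫⁻ w in Metric.closedBall c (δ / 4), ENNReal.ofReal (∏ k, ‖w k‖ ^ (2 * α k)) := by
          refine setLIntegral_mono (by fun_prop) fun w hw => ENNReal.ofReal_le_ofReal ?_
          exact Finset.prod_le_prod (fun k _ => (pow_pos (hpos k) _).le) fun k _ =>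
            pow_le_pow_left₀ (hpos k).le (hlow w hw k) _
      _ ≤ _ := lintegral_mono_set hball
  have hprod : ∏ k, u k ^ (2 * α k) ≤ P * ∏ k, ((1 / (1 + δ / 2)) ^ 2) ^ α k := by
    rw [hP, ← Finset.prod_mul_distrib]
    refine Finset.prod_le_prod (fun k _ => pow_nonneg (hu k) _) fun k _ => ?_
    rw [← pow_mul, ← mul_pow]
    refine pow_le_pow_left₀ (hu k) ?_ _
    rw [mul_one_div, le_div_iff₀ (by positivity)]
    nlinarith [hu1 k]
  calc (monomialNormSq q α)⁻¹ * ∏ k, u k ^ (2 * α k)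
      ≤ (P * v)⁻¹ * (P * ∏ k, ((1 / (1 + δ / 2)) ^ 2) ^ α k) := by
        gcongr
        exact Finset.prod_nonneg fun k _ => pow_nonneg (hu k) _
    _ = v⁻¹ * ∏ k, ((1 / (1 + δ / 2)) ^ 2) ^ α k := by
        field_simp

/-- The summands of the orthogonal expansion of the Bergman kernel. -/
noncomputable def kernelTerm (q : ι → ℝ) (α : ι → ℕ) (z w : ι → ℂ) : ℂ :=
  ((monomialNormSq q α)⁻¹ : ℝ) * (∏ k, z k ^ α k) * conj (∏ k, w k ^ α k)

/-- The orthogonal expansion of the Bergman kernel of `∑ |z_k|^{2/q_k} < 1`. -/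
noncomputable def ellipsoidKernel (q : ι → ℝ) (z w : ι → ℂ) : ℂ := ∑' α, kernelTerm q α z w

/-- By Cauchy–Schwarz the point with coordinates √(|z_k||w_k|) lies in the sublevel set of height
√(N z) < 1. This height does not involve `w`, whence uniformity. -/
theorem exists_norm_kernelTerm_le (hq : ∀ k, 0 < q k) {z : ι → ℂ} (hz : z ∈ powerEllipsoid q) :
    ∃ C ρ : ℝ, 0 ≤ ρ ∧ ρ < 1 ∧ ∀ w ∈ powerEllipsoid q, ∀ α : ι → ℕ,
      ‖kernelTerm q α z w‖ ≤ C * ∏ k, ρ ^ α k := by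
  set N : (ι → ℂ) → ℝ := fun z => ∑ k, ‖z k‖ ^ (2 / q k) with hN
  have hs : √(N z) < 1 := by
    rw [Real.sqrt_lt' one_pos, one_pow]
    exact hz
  obtain ⟨C, ρ, h0, h1, h⟩ := exists_monomialNormSq_inv_mul_le hq hs
  refine ⟨C, ρ, h0, h1, fun w hw α => ?_⟩
  set u : ι → ℝ := fun k => √(‖z k‖ * ‖w k‖) with hu
  have hexp : ∀ (x : ℝ) k, 0 ≤ x → (x ^ (1 / q k)) ^ 2 = x ^ (2 / q k) := by
    intro x k hx
    rw [← Real.rpow_natCast, ← Real.rpow_mul hx]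
    congr 1
    push_cast
    ring
  have hsum : ∑ k, u k ^ (2 / q k) ≤ √(N z) := by
    calc ∑ k, u k ^ (2 / q k) = ∑ k, ‖z k‖ ^ (1 / q k) * ‖w k‖ ^ (1 / q k) := by
          refine Finset.sum_congr rfl fun k _ => ?_
          simp only [hu]
          rw [Real.sqrt_eq_rpow, ← Real.rpow_mul (by positivity),
            Real.mul_rpow (norm_nonneg _) (norm_nonneg _)]
          congr 2 <;> ring
      _ ≤ √(∑ k, (‖z k‖ ^ (1 / q k)) ^ 2) * √(∑ k, (‖w k‖ ^ (1 / q k)) ^ 2) :=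
          Real.sum_mul_le_sqrt_mul_sqrt _ _ _
      _ = √(N z) * √(N w) := by
          simp only [hexp _ _ (norm_nonneg _), hN]
      _ ≤ √(N z) * 1 := by
          gcongr
          rw [Real.sqrt_le_one]
          exact le_of_lt hw
      _ = _ := mul_one _
  refine le_of_eq_of_le ?_ (h u (fun k => Real.sqrt_nonneg _) hsum α)
  rw [kernelTerm, norm_mul, norm_mul, RCLike.norm_conj, norm_prod, norm_prod, Complex.norm_real,
    Real.norm_of_nonneg (inv_nonneg.2 (monomialNormSq_pos hq α).le), mul_assoc,
    ← Finset.prod_mul_distrib]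
  congr 1
  refine Finset.prod_congr rfl fun k _ => ?_
  simp only [hu]
  rw [pow_mul, Real.sq_sqrt (by positivity), norm_pow, norm_pow, mul_pow]

theorem summable_kernelTerm (hq : ∀ k, 0 < q k) {z w : ι → ℂ} (hz : z ∈ powerEllipsoid q)
    (hw : w ∈ powerEllipsoid q) : Summable fun α => kernelTerm q α z w := by
  obtain ⟨C, ρ, h0, h1, h⟩ := exists_norm_kernelTerm_le hq hz
  exact Summable.of_norm_bounded ((summable_prod_pow h0 h1).mul_left C) (h w hw)

end

/-! ### Holomorphic series, regrouping by degree, uniqueness of the kernel. -/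

/-- Cauchy estimates on a smaller ball turn the bounds on the terms into summable bounds on their
derivatives, so termwise differentiation applies. -/
theorem differentiableOn_tsum_of_summable_norm_of_isOpen {κ E : Type*} [NormedAddCommGroup E]
    [NormedSpace ℂ E] {f : κ → E → ℂ} {u : κ → ℝ} {s : Set E} (hu : Summable u) (hs : IsOpen s)
    (hf : ∀ i, DifferentiableOn ℂ (f i) s) (hfu : ∀ i, ∀ x ∈ s, ‖f i x‖ ≤ u i) :
    DifferentiableOn ℂ (fun x => ∑' i, f i x) s := by
  intro x₀ hx₀
  obtain ⟨R, hR, hRs⟩ := Metric.isOpen_iff.1 hs x₀ hx₀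
  have hhalf : Metric.ball x₀ (R / 2) ⊆ s :=
    (Metric.ball_subset_ball (by linarith)).trans hRs
  have hmem : x₀ ∈ Metric.ball x₀ (R / 2) := Metric.mem_ball_self (by positivity)
  have hbound : ∀ i, ∀ x ∈ Metric.ball x₀ (R / 2), ‖fderiv ℂ (f i) x‖ ≤ 2 * u i / (R / 2) := by
    intro i x hx
    have hsub : Metric.ball x (R / 2) ⊆ s := by
      refine (Metric.ball_subset_ball' ?_).trans hRs
      rw [Metric.mem_ball] at hx
      linarith
    refine Complex.norm_fderiv_le_div_of_mapsTo_ball ((hf i).mono hsub) (fun y hy => ?_)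
      (by positivity)
    rw [mem_closedBall_iff_norm]
    linarith [norm_sub_le (f i y) (f i x), hfu i y (hsub hy), hfu i x (hhalf hx)]
  exact (hasFDerivAt_tsum_of_isPreconnected ((hu.mul_left 2).div_const (R / 2)) Metric.isOpen_ball
    (convex_ball x₀ (R / 2)).isPreconnected
    (fun i x hx => ((hf i).differentiableAt (hs.mem_nhds (hhalf hx))).hasFDerivAt)
    hbound hmem (Summable.of_norm_bounded hu fun i => hfu i x₀ hx₀)
    hmem).differentiableAt.differentiableWithinAt

theorem differentiable_monomial {ι : Type*} [Fintype ι] (α : ι → ℕ) :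
    Differentiable ℂ fun w : ι → ℂ => ∏ k, w k ^ α k := by
  classical
  have h : ∀ s : Finset ι, Differentiable ℂ fun w : ι → ℂ => ∏ k ∈ s, w k ^ α k := by
    intro s
    induction s using Finset.induction_on with
    | empty => simp
    | insert a s ha ih =>
      simp only [Finset.prod_insert ha]
      exact ((differentiable_apply a).pow _).mul ih
  exact h Finset.univ

theorem HasSum.sum_piAntidiag {ι : Type*} [Fintype ι] [DecidableEq ι] {f : (ι → ℕ) → ℂ} {a : ℂ}
    (hf : HasSum f a) : HasSum (fun m => ∑ α ∈ Finset.piAntidiag Finset.univ m, f α) a := by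
  have h := hf.tsum_fiberwise fun α => ∑ k, α k
  have hset : ∀ m : ℕ, (fun α : ι → ℕ => ∑ k, α k) ⁻¹' {m} =
      (Finset.piAntidiag (Finset.univ : Finset ι) m : Set (ι → ℕ)) := by
    intro m
    ext α
    simp
  have heq : (fun m => ∑ α ∈ Finset.piAntidiag Finset.univ m, f α) =
      fun m => ∑' b : (fun α : ι → ℕ => ∑ k, α k) ⁻¹' {m}, f b := by
    ext m
    rw [← Finset.tsum_subtype' (Finset.piAntidiag Finset.univ m) f, hset m]
  rw [heq]
  exact h

/-- Both kernels reproduce the difference g of their conjugates; subtracting gives ∫|g|² = 0, and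
continuity upgrades vanishing a.e. to vanishing on the open set. -/
theorem IsBergmanKernel.eq_of_mem {ι : Type*} [Fintype ι] {Ω : Set (ι → ℂ)} (hΩ : IsOpen Ω)
    {K₁ K₂ : (ι → ℂ) → (ι → ℂ) → ℂ} (h₁ : IsBergmanKernel Ω K₁) (h₂ : IsBergmanKernel Ω K₂)
    {z w : ι → ℂ} (hz : z ∈ Ω) (hw : w ∈ Ω) : K₁ z w = K₂ z w := by
  set g : (ι → ℂ) → ℂ := fun w => conj (K₁ z w) - conj (K₂ z w) with hg
  have m₁ := h₁.mem z hz
  have m₂ := h₂.mem z hz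
  have hgm : IsBergmanFunction Ω g := ⟨m₁.1.sub m₂.1, m₁.2.sub m₂.2⟩
  have n₁ : MemLp (K₁ z) 2 (volume.restrict Ω) := by
    have := m₁.2.star
    simpa [Function.comp_def, Pi.star_def] using this
  have n₂ : MemLp (K₂ z) 2 (volume.restrict Ω) := by
    have := m₂.2.star
    simpa [Function.comp_def, Pi.star_def] using this
  have i₁ : Integrable (fun w => g w * K₁ z w) (volume.restrict Ω) := hgm.2.integrable_mul n₁
  have i₂ : Integrable (fun w => g w * K₂ z w) (volume.restrict Ω) := hgm.2.integrable_mul n₂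
  have h0 : ∫ w in Ω, (g w * K₁ z w - g w * K₂ z w) = 0 := by
    rw [integral_sub i₁ i₂, ← h₁.reproducing g hgm z hz, ← h₂.reproducing g hgm z hz, sub_self]
  have hsq : ∀ w, g w * K₁ z w - g w * K₂ z w = ((‖g w‖ ^ 2 : ℝ) : ℂ) := by
    intro w
    rw [← mul_sub, ← Complex.normSq_eq_norm_sq, ← Complex.mul_conj]
    simp [hg]
  have hint : Integrable (fun w => ‖g w‖ ^ 2) (volume.restrict Ω) := by
    simpa using hgm.2.integrable_norm_pow two_ne_zero
  simp only [hsq] at h0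
  rw [integral_complex_ofReal, Complex.ofReal_eq_zero,
    integral_eq_zero_iff_of_nonneg (fun w => by positivity) hint] at h0
  have hae : g =ᵐ[volume.restrict Ω] fun _ => 0 := by
    filter_upwards [h0] with w hw
    simpa using hw
  have := Measure.eqOn_open_of_ae_eq hae hΩ hgm.1.continuousOn continuousOn_const hw
  have h3 : conj (K₁ z w) = conj (K₂ z w) := sub_eq_zero.1 this
  exact (starRingEnd ℂ).injective h3

/-! ### The reproducing property. -/

section

variable {ι : Type*} [Fintype ι] {q : ι → ℝ}

theorem isBergmanFunction_conj_ellipsoidKernel (hq : ∀ k, 0 < q k) {z : ι → ℂ}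
    (hz : z ∈ powerEllipsoid q) :
    IsBergmanFunction (powerEllipsoid q) fun w => conj (ellipsoidKernel q z w) := by
  obtain ⟨C, ρ, h0, h1, h⟩ := exists_norm_kernelTerm_le hq hz
  have hsum := (summable_prod_pow (ι := ι) h0 h1).mul_left C
  have hD : DifferentiableOn ℂ (fun w => conj (ellipsoidKernel q z w)) (powerEllipsoid q) := by
    have heq : (fun w => conj (ellipsoidKernel q z w)) =
        fun w => ∑' α, conj (kernelTerm q α z w) := by
      ext w
      rw [ellipsoidKernel, Complex.conj_tsum]
    rw [heq]
    refine differentiableOn_tsum_of_summable_norm_of_isOpen hsum (isOpen_powerEllipsoid hq)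
      (fun α => ?_) (fun α w hw => ?_)
    · simp only [kernelTerm, map_mul, Complex.conj_conj]
      exact ((differentiable_monomial α).const_mul _).differentiableOn
    · rw [RCLike.norm_conj]
      exact h w hw α
  refine ⟨hD, ?_⟩
  have hfin : IsFiniteMeasure (volume.restrict (powerEllipsoid q)) :=
    ⟨by simpa using volume_powerEllipsoid_lt_top hq⟩
  refine MemLp.of_bound
    (hD.continuousOn.aestronglyMeasurable (measurableSet_powerEllipsoid hq))
    (∑' α : ι → ℕ, C * ∏ k, ρ ^ α k) ?_
  filter_upwards [ae_restrict_mem (measurableSet_powerEllipsoid hq)] with w hw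
  rw [RCLike.norm_conj]
  exact tsum_of_norm_bounded hsum.hasSum (h w hw)

theorem measurePreserving_torusRotation_restrict (c : ι → Circle) :
    MeasurePreserving (torusRotation c) (volume.restrict (powerEllipsoid q))
      (volume.restrict (powerEllipsoid q)) := by
  have h := (measurePreserving_torusRotation c).restrict_preimage_emb
    (torusRotation c).measurableEmbedding (powerEllipsoid q)
  rwa [show torusRotation c ⁻¹' powerEllipsoid q = powerEllipsoid q from
    Set.ext fun w => torusRotation_mem_powerEllipsoid c w] at h

theorem smul_mem_powerEllipsoid (hq : ∀ k, 0 < q k) {w : ι → ℂ} (hw : w ∈ powerEllipsoid q)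
    {ζ : ℂ} (hζ : ‖ζ‖ ≤ 1) : ζ • w ∈ powerEllipsoid q :=
  powerEllipsoid_of_norm_le hq hw fun k => by
    simpa using mul_le_of_le_one_left (norm_nonneg (w k)) hζ

theorem differentiableOn_comp_smul_const {f : (ι → ℂ) → ℂ} {s : Set (ι → ℂ)}
    (hf : DifferentiableOn ℂ f s) {t : Set ℂ} {w : ι → ℂ} (h : ∀ ζ ∈ t, ζ • w ∈ s) :
    DifferentiableOn ℂ (fun ζ : ℂ => f (ζ • w)) t :=
  hf.comp (f := fun ζ : ℂ => ζ • w) (by fun_prop) h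

/-- The Taylor coefficient along a line as an average over a circle. -/
theorem integral_circle_eq_iteratedDeriv (hq : ∀ k, 0 < q k) {f : (ι → ℂ) → ℂ}
    (hf : DifferentiableOn ℂ f (powerEllipsoid q)) {w : ι → ℂ} (hw : w ∈ powerEllipsoid q)
    (m : ℕ) :
    ∫ θ in (0 : ℝ)..2 * Real.pi, conj (circleMap 0 1 θ) ^ m * f (circleMap 0 1 θ • w) =
      (2 * Real.pi / m.factorial) * iteratedDeriv m (fun ζ : ℂ => f (ζ • w)) 0 := by
  have h := (differentiableOn_comp_smul_const hf (t := Metric.closedBall 0 1) (w := w)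
    fun ζ hζ => smul_mem_powerEllipsoid hq hw (by simpa using hζ)
    ).circleIntegral_one_div_sub_center_pow_smul one_pos m
  have h1 : ∀ θ, deriv (circleMap 0 1) θ • ((1 / (circleMap 0 1 θ - 0) ^ (m + 1)) •
      f (circleMap 0 1 θ • w)) =
      Complex.I * (conj (circleMap 0 1 θ) ^ m * f (circleMap 0 1 θ • w)) := by
    intro θ
    have hne : circleMap 0 1 θ ≠ 0 := by simp
    have hconj : conj (circleMap 0 1 θ) = (circleMap 0 1 θ)⁻¹ := by
      rw [Complex.inv_def, Complex.normSq_eq_norm_sq]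
      simp
    rw [deriv_circleMap, hconj, sub_zero, smul_eq_mul, smul_eq_mul, inv_pow, pow_succ]
    field_simp
  rw [circleIntegral] at h
  simp only [h1] at h
  rw [intervalIntegral.integral_const_mul, smul_eq_mul] at h
  apply mul_left_cancel₀ Complex.I_ne_zero
  rw [h]
  ring

/-- Replacing w by e^{iθ}w leaves the integral unchanged and multiplies the conjugate monomial by
e^{-imθ}, m = |α|. Averaging over θ and swapping integrals leaves only the m-homogeneous part of f,
so completeness of the monomials is never needed. -/
theorem setIntegral_mul_conj_monomial (hq : ∀ k, 0 < q k) {f : (ι → ℂ) → ℂ}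
    (hf : IsBergmanFunction (powerEllipsoid q) f) (α : ι → ℕ) :
    ∫ w in powerEllipsoid q, f w * conj (∏ k, w k ^ α k) =
      ∫ w in powerEllipsoid q, (((∑ k, α k).factorial : ℂ)⁻¹ *
        iteratedDeriv (∑ k, α k) (fun ζ : ℂ => f (ζ • w)) 0) * conj (∏ k, w k ^ α k) := by
  set m := ∑ k, α k with hm
  set D := powerEllipsoid q with hD
  have hDm : MeasurableSet D := measurableSet_powerEllipsoid hq
  have hfin : IsFiniteMeasure (volume.restrict D) :=
    ⟨by simpa using volume_powerEllipsoid_lt_top hq⟩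
  set P : (ι → ℂ) → ℂ := fun w => conj (∏ k, w k ^ α k) with hP
  have hPc : Continuous P := by
    refine Complex.continuous_conj.comp ?_
    fun_prop
  have hP1 : ∀ w ∈ D, ‖P w‖ ≤ 1 := by
    intro w hw
    rw [hP, RCLike.norm_conj, norm_prod]
    refine Finset.prod_le_one (fun k _ => norm_nonneg _) fun k _ => ?_
    rw [norm_pow]
    exact pow_le_one₀ (norm_nonneg _) (norm_le_one_of_mem_powerEllipsoid hq hw k)
  have hint : Integrable (fun w => f w * P w) (volume.restrict D) := by
    refine (hf.2.integrable one_le_two).mul_bdd (c := 1) hPc.aestronglyMeasurable ?_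
    filter_upwards [ae_restrict_mem hDm] with w hw using hP1 w hw
  let c : ℝ → ι → Circle := fun θ _ => Circle.exp θ
  have hc : ∀ θ w, torusRotation (c θ) w = circleMap 0 1 θ • w := by
    intro θ w
    ext k
    rw [torusRotation_apply]
    simp [c, circleMap, Circle.coe_exp]
  let F : ℝ → (ι → ℂ) → ℂ := fun θ w => conj (circleMap 0 1 θ) ^ m * f (circleMap 0 1 θ • w) * P w
  have hF : ∀ θ w, F θ w = f (torusRotation (c θ) w) * P (torusRotation (c θ) w) := by
    intro θ w
    have : P (circleMap 0 1 θ • w) = conj (circleMap 0 1 θ) ^ m * P w := by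
      simp only [hP, Pi.smul_apply, smul_eq_mul, mul_pow, Finset.prod_mul_distrib,
        Finset.prod_pow_eq_pow_sum, map_mul, map_pow, hm]
    rw [hc, this]
    simp only [F]
    ring
  have hFint : ∀ θ, Integrable (F θ) (volume.restrict D) := by
    intro θ
    rw [funext (hF θ)]
    exact ((measurePreserving_torusRotation_restrict (c θ)).integrable_comp_emb
      (torusRotation (c θ)).measurableEmbedding).2 hint
  have hFval : ∀ θ, ∫ w in D, F θ w = ∫ w in D, f w * P w := by
    intro θ
    rw [funext (hF θ)]
    exact (measurePreserving_torusRotation_restrict (c θ)).integral_comp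
      (torusRotation (c θ)).measurableEmbedding (fun w => f w * P w)
  have hFnorm : ∀ θ, ∫ w in D, ‖F θ w‖ = ∫ w in D, ‖f w * P w‖ := by
    intro θ
    rw [funext (hF θ)]
    exact (measurePreserving_torusRotation_restrict (c θ)).integral_comp
      (torusRotation (c θ)).measurableEmbedding (fun w => ‖f w * P w‖)
  have hprod : Integrable (Function.uncurry F)
      ((volume.restrict (Set.uIoc 0 (2 * Real.pi))).prod (volume.restrict D)) := by
    rw [integrable_prod_iff]
    · refine ⟨Filter.Eventually.of_forall hFint, ?_⟩
      simp only [Function.uncurry_apply_pair, hFnorm]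
      rw [Set.uIoc_of_le Real.two_pi_pos.le]
      exact integrable_const _
    · rw [Measure.prod_restrict]
      refine ContinuousOn.aestronglyMeasurable ?_ (measurableSet_uIoc.prod hDm)
      have hcm : Continuous fun x : ℝ × (ι → ℂ) => circleMap 0 1 x.1 :=
        (continuous_circleMap 0 1).comp continuous_fst
      refine ContinuousOn.mul (ContinuousOn.mul ?_ ?_) (hPc.comp continuous_snd).continuousOn
      · exact ((Complex.continuous_conj.comp hcm).pow m).continuousOn
      · refine hf.1.continuousOn.comp (hcm.smul continuous_snd).continuousOn fun x hx => ?_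
        exact smul_mem_powerEllipsoid hq hx.2 (by simp)
  have hswap := intervalIntegral_integral_swap (f := F) hprod
  simp only [hFval, intervalIntegral.integral_const, sub_zero] at hswap
  have hpi : ((2 * Real.pi : ℝ) : ℂ) ≠ 0 := by
    exact_mod_cast Real.two_pi_pos.ne'
  apply mul_left_cancel₀ hpi
  rw [← Complex.real_smul, hswap, ← integral_const_mul]
  refine setIntegral_congr_fun hDm fun w hw => ?_
  simp only [F]
  rw [intervalIntegral.integral_mul_const, integral_circle_eq_iteratedDeriv hq hf.1 hw]
  push_cast
  ring

end

section

variable {ι : Type*} [Fintype ι] [DecidableEq ι] {q : ι → ℝ}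

theorem prod_comp_eq_monomial {m : ℕ} (σ : Fin m → ι) (w : ι → ℂ) :
    ∏ i, w (σ i) = ∏ k, w k ^ (Finset.univ.filter fun i => σ i = k).card := by
  rw [← Finset.prod_fiberwise Finset.univ σ]
  refine Finset.prod_congr rfl fun k _ => ?_
  rw [Finset.prod_congr rfl fun i hi => by rw [(Finset.mem_filter.1 hi).2], Finset.prod_const]

theorem card_fiber_mem_piAntidiag {m : ℕ} (σ : Fin m → ι) :
    (fun k => (Finset.univ.filter fun i => σ i = k).card) ∈
      Finset.piAntidiag (Finset.univ : Finset ι) m := by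
  rw [Finset.mem_piAntidiag]
  refine ⟨?_, fun k _ => Finset.mem_univ k⟩
  rw [← Finset.card_eq_sum_card_fiberwise (f := σ) (s := Finset.univ) fun _ _ =>
    Finset.mem_coe.2 (Finset.mem_univ _), Finset.card_univ, Fintype.card_fin]

/-- After `setIntegral_mul_conj_monomial`, f is replaced by a homogeneous polynomial, for which
orthogonality reads off each coefficient. -/
theorem sum_setIntegral_mul_kernelTerm (hq : ∀ k, 0 < q k) {f : (ι → ℂ) → ℂ}
    (hf : IsBergmanFunction (powerEllipsoid q) f) (z : ι → ℂ) (m : ℕ) :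
    ∑ α ∈ Finset.piAntidiag Finset.univ m, ∫ w in powerEllipsoid q, f w * kernelTerm q α z w =
      (m.factorial : ℂ)⁻¹ * iteratedDeriv m (fun ζ : ℂ => f (ζ • z)) 0 := by
  obtain ⟨C, hC⟩ := exists_iteratedDeriv_smul_eq_sum (isOpen_powerEllipsoid hq)
    (zero_mem_powerEllipsoid hq) hf.1 m
  set β : (Fin m → ι) → ι → ℕ := fun σ k => (Finset.univ.filter fun i => σ i = k).card with hβ
  have hC' : ∀ w : ι → ℂ, iteratedDeriv m (fun ζ : ℂ => f (ζ • w)) 0 =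
      ∑ σ, C σ * ∏ k, w k ^ β σ k := fun w => by
    rw [hC w]
    exact Finset.sum_congr rfl fun σ _ => by rw [prod_comp_eq_monomial]
  have hint : ∀ α γ : ι → ℕ, Integrable (fun w : ι → ℂ => (∏ k, w k ^ γ k) *
      conj (∏ k, w k ^ α k)) (volume.restrict (powerEllipsoid q)) := by
    intro α γ
    have hc : Continuous fun w : ι → ℂ => (∏ k, w k ^ γ k) * conj (∏ k, w k ^ α k) :=
      Continuous.mul (by fun_prop) (Complex.continuous_conj.comp (by fun_prop))
    exact (hc.continuousOn.integrableOn_compact (isCompact_closedBall 0 1)).mono_set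
      (powerEllipsoid_subset_closedBall hq)
  have hterm : ∀ α ∈ Finset.piAntidiag (Finset.univ : Finset ι) m,
      ∫ w in powerEllipsoid q, f w * kernelTerm q α z w =
        (m.factorial : ℂ)⁻¹ * ∑ σ, if β σ = α then C σ * ∏ k, z k ^ α k else 0 := by
    intro α hα
    have hsum : ∑ k, α k = m := (Finset.mem_piAntidiag.1 hα).1
    have h1 : ∀ w, f w * kernelTerm q α z w =
        (((monomialNormSq q α)⁻¹ : ℝ) * ∏ k, z k ^ α k) * (f w * conj (∏ k, w k ^ α k)) := by
      intro w
      rw [kernelTerm]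
      ring
    simp only [h1]
    rw [integral_const_mul, setIntegral_mul_conj_monomial hq hf, hsum]
    have h2 : ∀ w : ι → ℂ, ((m.factorial : ℂ)⁻¹ * iteratedDeriv m (fun ζ : ℂ => f (ζ • w)) 0) *
        conj (∏ k, w k ^ α k) = (m.factorial : ℂ)⁻¹ *
          ∑ σ, C σ * ((∏ k, w k ^ β σ k) * conj (∏ k, w k ^ α k)) := by
      intro w
      rw [hC', mul_assoc, Finset.sum_mul]
      simp only [mul_assoc]
    simp only [h2]
    rw [integral_const_mul, integral_finsetSum _ fun σ _ => (hint α (β σ)).const_mul _,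
      mul_left_comm, Finset.mul_sum]
    congr 1
    refine Finset.sum_congr rfl fun σ _ => ?_
    rw [integral_const_mul]
    split_ifs with h
    · rw [h, setIntegral_monomial_mul_conj_self hq, Complex.ofReal_inv]
      have : (monomialNormSq q α : ℂ) ≠ 0 := by
        exact_mod_cast (monomialNormSq_pos hq α).ne'
      field_simp
    · rw [setIntegral_monomial_mul_conj_of_ne h]
      simp
  rw [Finset.sum_congr rfl hterm, ← Finset.mul_sum, Finset.sum_comm, hC']
  congr 1
  refine Finset.sum_congr rfl fun σ _ => ?_
  rw [Finset.sum_ite_eq, if_pos (card_fiber_mem_piAntidiag σ)]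

omit [DecidableEq ι] in
theorem hasSum_taylor_smul (hq : ∀ k, 0 < q k) {f : (ι → ℂ) → ℂ}
    (hf : DifferentiableOn ℂ f (powerEllipsoid q)) {z : ι → ℂ} (hz : z ∈ powerEllipsoid q) :
    HasSum (fun m : ℕ => (m.factorial : ℂ)⁻¹ * iteratedDeriv m (fun ζ : ℂ => f (ζ • z)) 0)
      (f z) := by
  -- Openness gives a disc of radius above 1, so that ζ = 1 is interior to the disc of convergence.
  obtain ⟨R, hR1, hR⟩ : ∃ R : ℝ, 1 < R ∧ (R : ℂ) • z ∈ powerEllipsoid q := by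
    have h1 : ∀ᶠ R : ℝ in nhds 1, (R : ℂ) • z ∈ powerEllipsoid q := by
      have hc : Continuous fun R : ℝ => (R : ℂ) • z := by fun_prop
      exact hc.continuousAt.eventually ((isOpen_powerEllipsoid hq).mem_nhds (by simpa using hz))
    obtain ⟨R, h2, h3⟩ := ((h1.filter_mono nhdsWithin_le_nhds).and
      (self_mem_nhdsWithin (a := (1 : ℝ)) (s := Set.Ioi 1))).exists
    exact ⟨R, h3, h2⟩
  have hdiff : DifferentiableOn ℂ (fun ζ : ℂ => f (ζ • z)) (Metric.ball 0 R) := by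
    refine differentiableOn_comp_smul_const hf fun ζ hζ => ?_
    refine powerEllipsoid_of_norm_le hq hR fun k => ?_
    rw [mem_ball_zero_iff] at hζ
    simp only [Pi.smul_apply, smul_eq_mul, norm_mul, Complex.norm_real]
    exact mul_le_mul_of_nonneg_right (hζ.le.trans (le_abs_self R)) (norm_nonneg _)
  have h := Complex.hasSum_taylorSeries_on_ball hdiff (z := 1) (by simpa using hR1)
  simpa using h

omit [DecidableEq ι] in
/-- The power ellipsoid has a Bergman kernel, given by its orthogonal expansion in monomials. -/
theorem isBergmanKernel_ellipsoidKernel (hq : ∀ k, 0 < q k) :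
    IsBergmanKernel (powerEllipsoid q) (ellipsoidKernel q) := by
  classical
  refine ⟨fun z hz => isBergmanFunction_conj_ellipsoidKernel hq hz, fun f hf z hz => ?_⟩
  have hDm := measurableSet_powerEllipsoid hq
  have hfin : IsFiniteMeasure (volume.restrict (powerEllipsoid q)) :=
    ⟨by simpa using volume_powerEllipsoid_lt_top hq⟩
  have hfi : Integrable f (volume.restrict (powerEllipsoid q)) := hf.2.integrable one_le_two
  obtain ⟨C, ρ, h0, h1, h⟩ := exists_norm_kernelTerm_le hq hz
  have hsum := (summable_prod_pow (ι := ι) h0 h1).mul_left C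
  have hS : HasSum (fun α => ∫ w in powerEllipsoid q, f w * kernelTerm q α z w)
      (∫ w in powerEllipsoid q, f w * ellipsoidKernel q z w) := by
    refine hasSum_integral_of_dominated_convergence
      (fun α w => ‖f w‖ * (C * ∏ k, ρ ^ α k)) (fun α => ?_) (fun α => ?_) ?_ ?_ ?_
    · refine hfi.aestronglyMeasurable.mul (Continuous.aestronglyMeasurable ?_)
      unfold kernelTerm
      exact continuous_const.mul (Complex.continuous_conj.comp (by fun_prop))
    · filter_upwards [ae_restrict_mem hDm] with w hw
      rw [norm_mul]
      exact mul_le_mul_of_nonneg_left (h w hw α) (norm_nonneg _)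
    · exact Filter.Eventually.of_forall fun w => hsum.mul_left _
    · simp only [tsum_mul_left]
      exact hfi.norm.mul_const _
    · filter_upwards [ae_restrict_mem hDm] with w hw
      exact (summable_kernelTerm hq hz hw).hasSum.mul_left _
  have hS' := hS.sum_piAntidiag
  simp only [sum_setIntegral_mul_kernelTerm hq hf z] at hS'
  exact (hasSum_taylor_smul hq hf.1 hz).unique hS'

end

/-! ### Binomial series and termwise derivatives in t. -/

theorem one_sub_mem_slitPlane {t : ℂ} (ht : ‖t‖ < 1) : 1 - t ∈ Complex.slitPlane := by
  left
  have := (Complex.abs_re_le_norm t).trans_lt ht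
  rw [abs_lt] at this
  simp only [Complex.sub_re, Complex.one_re]
  linarith

theorem hasDerivAt_one_sub_cpow (b : ℂ) {t : ℂ} (ht : ‖t‖ < 1) :
    HasDerivAt (fun t : ℂ => (1 - t) ^ b) (-b * (1 - t) ^ (b - 1)) t := by
  have h := ((hasDerivAt_id t).const_sub 1).cpow_const (c := b) (one_sub_mem_slitPlane ht)
  simpa [neg_mul, mul_comm] using h

theorem iteratedDeriv_one_sub_cpow_neg {a : ℝ} (ha : 0 < a) (N : ℕ) :
    ∀ {t : ℂ}, ‖t‖ < 1 → iteratedDeriv N (fun t : ℂ => (1 - t) ^ (-(a : ℂ))) t =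
      ((Real.Gamma (a + N) / Real.Gamma a : ℝ) : ℂ) * (1 - t) ^ (-((a + N : ℝ) : ℂ)) := by
  induction N with
  | zero =>
    intro t _
    simp [div_self (Real.Gamma_pos_of_pos ha).ne']
  | succ N ih =>
    intro t ht
    have hev : iteratedDeriv N (fun t : ℂ => (1 - t) ^ (-(a : ℂ))) =ᶠ[nhds t] fun t =>
        ((Real.Gamma (a + N) / Real.Gamma a : ℝ) : ℂ) * (1 - t) ^ (-((a + N : ℝ) : ℂ)) := by
      filter_upwards [Metric.isOpen_ball.mem_nhds (mem_ball_zero_iff.2 ht)] with s hs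
      exact ih (mem_ball_zero_iff.1 hs)
    have hpos : 0 < a + N := by positivity
    rw [iteratedDeriv_succ, hev.deriv_eq, ((hasDerivAt_one_sub_cpow _ ht).const_mul _).deriv,
      neg_neg, ← mul_assoc]
    have h1 : Real.Gamma (a + (N + 1 : ℕ)) = (a + N) * Real.Gamma (a + N) := by
      rw [← Real.Gamma_add_one hpos.ne']
      congr 1
      push_cast
      ring
    rw [h1]
    congr 1
    · push_cast
      ring
    · congr 1
      push_cast
      ring

/-- The binomial series for a real exponent. -/
theorem hasSum_one_sub_cpow_neg {a : ℝ} (ha : 0 < a) {t : ℂ} (ht : ‖t‖ < 1) :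
    HasSum (fun m : ℕ => ((Real.Gamma (a + m) / Real.Gamma a / m.factorial : ℝ) : ℂ) * t ^ m)
      ((1 - t) ^ (-(a : ℂ))) := by
  have hd : DifferentiableOn ℂ (fun t : ℂ => (1 - t) ^ (-(a : ℂ))) (Metric.ball 0 1) :=
    fun s hs => (hasDerivAt_one_sub_cpow _
      (mem_ball_zero_iff.1 hs)).differentiableAt.differentiableWithinAt
  have h := Complex.hasSum_taylorSeries_on_ball hd (z := t) (by simpa using ht)
  have heq : (fun m : ℕ => ((Real.Gamma (a + m) / Real.Gamma a / m.factorial : ℝ) : ℂ) * t ^ m) =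
      fun m : ℕ => (m.factorial : ℂ)⁻¹ • (t - 0) ^ m •
        iteratedDeriv m (fun t : ℂ => (1 - t) ^ (-(a : ℂ))) 0 := by
    ext m
    rw [iteratedDeriv_one_sub_cpow_neg ha m (by simp), sub_zero, sub_zero, Complex.one_cpow]
    push_cast
    simp only [smul_eq_mul, mul_one]
    ring
  rw [heq]
  exact h

theorem TendstoLocallyUniformlyOn.iteratedDeriv {κ : Type*} {φ : Filter κ} {F : κ → ℂ → ℂ}
    {f : ℂ → ℂ} {U : Set ℂ} (hU : IsOpen U) (hF : ∀ᶠ n in φ, DifferentiableOn ℂ (F n) U)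
    (hf : TendstoLocallyUniformlyOn F f φ U) (k : ℕ) :
    TendstoLocallyUniformlyOn (fun n => iteratedDeriv k (F n)) (iteratedDeriv k f) φ U ∧
      ∀ᶠ n in φ, DifferentiableOn ℂ (iteratedDeriv k (F n)) U := by
  induction k with
  | zero => simpa using ⟨hf, hF⟩
  | succ k ih =>
    simp only [iteratedDeriv_succ]
    exact ⟨ih.1.deriv ih.2 hU, ih.2.mono fun n hn => hn.deriv hU⟩

theorem one_sub_cpow_neg_mul (r : ℝ) (t : ℂ) (β : ℕ) :
    (1 - t) ^ (-((r * (β + 1) : ℝ) : ℂ)) = (((1 - t) ^ (r : ℂ))⁻¹) ^ (β + 1) := by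
  rw [Complex.cpow_neg, inv_pow, ← Complex.cpow_mul_nat]
  push_cast
  rfl

/-- With x = (1-t)^r, expand 1/(x - v) = ∑ v^β x^{-(β+1)}. For |t| < 1 - |v|^{1/r} one has |v| <
(1-|t|)^r ≤ |x|, so the series converges locally uniformly and may be differentiated term by term.
-/
theorem hasSum_iteratedDeriv_inv_sub {r : ℝ} (hr : 0 < r) {v t : ℂ}
    (ht : ‖t‖ + ‖v‖ ^ (1 / r) < 1) (N : ℕ) (c : ℂ) :
    HasSum (fun β : ℕ => v ^ β * (c * (((Real.Gamma (r * (β + 1) + N) /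
      Real.Gamma (r * (β + 1)) : ℝ) : ℂ) * (1 - t) ^ (-((r * (β + 1) + N : ℝ) : ℂ)))))
      (iteratedDeriv N (fun t : ℂ => c / ((1 - t) ^ (r : ℂ) - v)) t) := by
  set R : ℝ := 1 - ‖v‖ ^ (1 / r) with hR
  have hv0 : 0 ≤ ‖v‖ ^ (1 / r) := Real.rpow_nonneg (norm_nonneg v) _
  have htR : t ∈ Metric.ball (0 : ℂ) R := by
    rw [mem_ball_zero_iff]; linarith
  have hlt1 : ∀ s ∈ Metric.ball (0 : ℂ) R, ‖s‖ < 1 := fun s hs => by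
    rw [mem_ball_zero_iff] at hs; linarith
  let f : ℕ → ℂ → ℂ := fun β s => (v ^ β * c) * (1 - s) ^ (-((r * (β + 1) : ℝ) : ℂ))
  have hfd : ∀ β, ∀ s ∈ Metric.ball (0 : ℂ) R, DifferentiableAt ℂ (f β) s := fun β s hs =>
    ((hasDerivAt_one_sub_cpow _ (hlt1 s hs)).const_mul _).differentiableAt
  have hloc : TendstoLocallyUniformlyOn (fun (n : Finset ℕ) s => ∑ β ∈ n, f β s)
      (fun s => c / ((1 - s) ^ (r : ℂ) - v)) Filter.atTop (Metric.ball 0 R) := by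
    have hv : ∀ ρ : ℝ, 0 ≤ ρ → ρ < R → ‖v‖ < (1 - ρ) ^ r := by
      intro ρ h0 hρ
      calc ‖v‖ = (‖v‖ ^ (1 / r)) ^ r := by
            rw [← Real.rpow_mul (norm_nonneg v), one_div_mul_cancel hr.ne', Real.rpow_one]
        _ < (1 - ρ) ^ r := Real.rpow_lt_rpow hv0 (by linarith) hr
    have hx : ∀ s : ℂ, ∀ ρ < 1, ‖s‖ ≤ ρ → (1 - ρ) ^ r ≤ ‖(1 - s) ^ (r : ℂ)‖ := by
      intro s ρ hρ hs
      rw [Complex.norm_cpow_real]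
      refine Real.rpow_le_rpow (by linarith) ?_ hr.le
      have := norm_sub_norm_le (1 : ℂ) s
      rw [norm_one] at this
      linarith
    rw [tendstoLocallyUniformlyOn_iff_forall_isCompact Metric.isOpen_ball]
    intro K hKR hK
    obtain ⟨ρ, hρ0, hρR, hρ⟩ : ∃ ρ, 0 ≤ ρ ∧ ρ < R ∧ ∀ s ∈ K, ‖s‖ ≤ ρ := by
      rcases K.eq_empty_or_nonempty with rfl | hne
      · exact ⟨0, le_rfl, by linarith [norm_nonneg t], by simp⟩
      · obtain ⟨x, hx, hmax⟩ := hK.exists_isMaxOn hne continuous_norm.continuousOn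
        exact ⟨‖x‖, norm_nonneg x, by simpa using hKR hx, fun s hs => hmax hs⟩
    set y : ℝ := (1 - ρ) ^ r with hy
    have hy0 : 0 < y := Real.rpow_pos_of_pos (by linarith) r
    have hvy : ‖v‖ / y < 1 := (div_lt_one hy0).2 (hv ρ hρ0 hρR)
    have hsumm : Summable fun β : ℕ => (‖c‖ / y) * (‖v‖ / y) ^ β :=
      (summable_geometric_of_lt_one (by positivity) hvy).mul_left _
    have hbd : ∀ β : ℕ, ∀ s ∈ K, ‖f β s‖ ≤ (‖c‖ / y) * (‖v‖ / y) ^ β := by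
      intro β s hs
      have hys := hx s ρ (by linarith) (hρ s hs)
      simp only [f]
      rw [one_sub_cpow_neg_mul, norm_mul, norm_mul, norm_pow, norm_pow, norm_inv]
      calc ‖v‖ ^ β * ‖c‖ * ‖(1 - s) ^ (r : ℂ)‖⁻¹ ^ (β + 1)
          ≤ ‖v‖ ^ β * ‖c‖ * y⁻¹ ^ (β + 1) := by gcongr
        _ = (‖c‖ / y) * (‖v‖ / y) ^ β := by
            rw [div_pow, pow_succ, inv_pow]
            field_simp
    refine (tendstoUniformlyOn_tsum hsumm hbd).congr_right fun s hs => ?_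
    have hys := hx s ρ (by linarith) (hρ s hs)
    have hne : (1 - s) ^ (r : ℂ) ≠ 0 := norm_pos_iff.1 (hy0.trans_le hys)
    have hgeo : ‖v * ((1 - s) ^ (r : ℂ))⁻¹‖ < 1 := by
      rw [norm_mul, norm_inv, ← div_eq_mul_inv, div_lt_one (hy0.trans_le hys)]
      exact (hv ρ hρ0 hρR).trans_le hys
    have hne' : (1 - s) ^ (r : ℂ) - v ≠ 0 := by
      intro h0
      rw [sub_eq_zero] at h0
      rw [← h0, mul_inv_cancel₀ hne, norm_one] at hgeo
      exact lt_irrefl _ hgeo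
    have hterm : ∀ β, f β s = (c * ((1 - s) ^ (r : ℂ))⁻¹) * (v * ((1 - s) ^ (r : ℂ))⁻¹) ^ β := by
      intro β
      simp only [f]
      rw [one_sub_cpow_neg_mul, mul_pow, pow_succ]
      ring
    simp only [hterm]
    rw [tsum_mul_left, tsum_geometric_of_norm_lt_one hgeo]
    have h3 : 1 - v * ((1 - s) ^ (r : ℂ))⁻¹ = ((1 - s) ^ (r : ℂ) - v) / (1 - s) ^ (r : ℂ) := by
      field_simp
    rw [h3]
    field_simp
  have hpart : ∀ n : Finset ℕ, DifferentiableOn ℂ (fun s => ∑ β ∈ n, f β s)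
      (Metric.ball 0 R) := fun n =>
    DifferentiableOn.fun_sum fun β _ s hs => (hfd β s hs).differentiableWithinAt
  have hlim := ((TendstoLocallyUniformlyOn.iteratedDeriv Metric.isOpen_ball
    (Filter.Eventually.of_forall hpart) hloc N).1.tendsto_at htR)
  rw [HasSum, SummationFilter.unconditional_filter]
  refine hlim.congr fun n => ?_
  rw [iteratedDeriv_fun_sum]
  · refine Finset.sum_congr rfl fun β _ => ?_
    have ha : 0 < r * ((β : ℝ) + 1) := by positivity
    simp only [f]
    rw [iteratedDeriv_const_mul_field, iteratedDeriv_one_sub_cpow_neg ha N (hlt1 t htR), mul_assoc]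
  · intro β _
    have hd : DifferentiableOn ℂ (f β) (Metric.ball 0 R) := fun s hs =>
      (hfd β s hs).differentiableWithinAt
    exact (hd.analyticAt (Metric.isOpen_ball.mem_nhds htR)).contDiffAt

/-! ### The roots-of-unity filter. -/

theorem sum_primitiveRoot_pow {p : ℕ} {ω : ℂ} (hω : IsPrimitiveRoot ω p) (c : ℕ) :
    ∑ j ∈ Finset.Icc 1 p, (ω ^ c) ^ j = if p ∣ c then (p : ℂ) else 0 := by
  split_ifs with h
  · rw [(hω.pow_eq_one_iff_dvd c).2 h]
    simp
  · have h1 : ω ^ c ≠ 1 := fun h' => h ((hω.pow_eq_one_iff_dvd c).1 h')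
    have h2 := mul_geom_sum (ω ^ c) p
    rw [← pow_mul, mul_comm c p, pow_mul, hω.pow_eq_one, one_pow, sub_self] at h2
    have h3 := (mul_eq_zero.1 h2).resolve_left (sub_ne_zero.2 h1)
    rw [← Finset.Ico_add_one_right_eq_Icc, Finset.sum_Ico_eq_sum_range]
    simp only [pow_add, pow_one, add_tsub_cancel_right]
    rw [← Finset.mul_sum, h3, mul_zero]

/-- Averaging powers of a linear form over roots of unity selects monomials by congruences. -/
theorem sum_prod_root_mul_sum_pow {n : ℕ} {p : Fin n → ℕ} {ξ : Fin n → ℂ}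
    (hξ : ∀ k, IsPrimitiveRoot (ξ k) (p k)) (u : Fin n → ℂ) (m : ℕ) :
    ∑ j ∈ Fintype.piFinset (fun k : Fin n => Finset.Icc 1 (p k)),
        (∏ k, ξ k ^ j k) * (∑ l, u l * ξ l ^ j l) ^ m =
      ∑ γ ∈ Finset.piAntidiag Finset.univ m, (m.factorial : ℂ) *
        ∏ k, u k ^ γ k / ((γ k).factorial : ℂ) * if p k ∣ γ k + 1 then (p k : ℂ) else 0 := by
  -- In the multinomial expansion the weight ξ_k^{j_k} raises the exponent of the root to γ_k + 1,
  -- which is why the congruence concerns γ_k + 1.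
  have h1 : ∀ j : Fin n → ℕ, (∏ k, ξ k ^ j k) * (∑ l, u l * ξ l ^ j l) ^ m =
      ∑ γ ∈ Finset.piAntidiag Finset.univ m, (m.factorial : ℂ) *
        ((∏ k, u k ^ γ k / ((γ k).factorial : ℂ)) * ∏ k, (ξ k ^ (γ k + 1)) ^ j k) := by
    intro j
    rw [Finset.sum_pow_eq_sum_piAntidiag, Finset.mul_sum]
    refine Finset.sum_congr rfl fun γ hγ => ?_
    have h2 := Nat.multinomial_spec Finset.univ γ
    rw [(Finset.mem_piAntidiag.1 hγ).1] at h2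
    have h3 : (∏ k, ((γ k).factorial : ℂ)) ≠ 0 :=
      Finset.prod_ne_zero_iff.2 fun k _ => by exact_mod_cast (γ k).factorial_ne_zero
    have h4 : (Nat.multinomial Finset.univ γ : ℂ) =
        (m.factorial : ℂ) / ∏ k, ((γ k).factorial : ℂ) := by
      rw [eq_div_iff h3, mul_comm, ← h2]
      push_cast
      rfl
    have h5 : ∏ k, (ξ k ^ (γ k + 1)) ^ j k = (∏ k, ξ k ^ j k) * ∏ k, (ξ k ^ j k) ^ γ k := by
      rw [← Finset.prod_mul_distrib]
      refine Finset.prod_congr rfl fun k _ => ?_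
      ring
    rw [h4, h5, Finset.prod_div_distrib]
    simp only [mul_pow, Finset.prod_mul_distrib]
    field_simp
  simp only [h1]
  rw [Finset.sum_comm]
  refine Finset.sum_congr rfl fun γ _ => ?_
  rw [← Finset.mul_sum, ← Finset.mul_sum, ← Finset.prod_univ_sum, Finset.prod_mul_distrib]
  simp only [sum_primitiveRoot_pow (hξ _)]

/-! ### Matching the expansion with the closed formula. -/

section

variable {n : ℕ} {p : Fin n → ℕ} {r : ℝ}

theorem generalDomain_eq_powerEllipsoid (p : Fin n → ℕ) (r : ℝ) :
    generalDomain p r =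
      powerEllipsoid (Fin.snoc (α := fun _ => ℝ) (fun k : Fin n => (p k : ℝ)) r) := by
  ext z
  simp [generalDomain, powerEllipsoid, Fin.sum_univ_castSucc]

theorem snoc_cast_pos (hp : ∀ k, 0 < p k) (hr : 0 < r) (k : Fin (n + 1)) :
    0 < Fin.snoc (α := fun _ => ℝ) (fun k : Fin n => (p k : ℝ)) r k := by
  induction k using Fin.lastCases with
  | last => simpa using hr
  | cast k => simpa using hp k

theorem sum_norm_sq_add_lt_one (hp : ∀ k, 0 < p k) {z : Fin (n + 1) → ℂ}
    (hz : foldPoint p z ∈ generalDomain p r) :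
    ∑ k : Fin n, ‖z k.castSucc‖ ^ 2 + ‖z (Fin.last n)‖ ^ (2 / r) < 1 := by
  have h : ∀ k : Fin n, ‖z k.castSucc ^ p k‖ ^ (2 / (p k : ℝ)) = ‖z k.castSucc‖ ^ 2 := by
    intro k
    have hk : (p k : ℝ) ≠ 0 := by exact_mod_cast (hp k).ne'
    rw [norm_pow, ← Real.rpow_natCast, ← Real.rpow_mul (norm_nonneg _), mul_div_cancel₀ _ hk,
      Real.rpow_two]
  simpa [generalDomain, foldPoint, h, -norm_pow] using hz

/-- The arithmetic–geometric mean inequality in each coordinate. This places every evaluation point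
in the disc required by `hasSum_iteratedDeriv_inv_sub`. -/
theorem sum_norm_mul_add_lt_one (hp : ∀ k, 0 < p k) {z w : Fin (n + 1) → ℂ}
    (hz : foldPoint p z ∈ generalDomain p r) (hw : foldPoint p w ∈ generalDomain p r) :
    ∑ k : Fin n, ‖z k.castSucc * conj (w k.castSucc)‖ +
      ‖z (Fin.last n) * conj (w (Fin.last n))‖ ^ (1 / r) < 1 := by
  have hz' := sum_norm_sq_add_lt_one hp hz
  have hw' := sum_norm_sq_add_lt_one hp hw
  have h1 : ∑ k : Fin n, ‖z k.castSucc * conj (w k.castSucc)‖ ≤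
      (∑ k : Fin n, ‖z k.castSucc‖ ^ 2 + ∑ k : Fin n, ‖w k.castSucc‖ ^ 2) / 2 := by
    rw [← Finset.sum_add_distrib, Finset.sum_div]
    refine Finset.sum_le_sum fun k _ => ?_
    rw [norm_mul, RCLike.norm_conj]
    linarith [two_mul_le_add_sq ‖z k.castSucc‖ ‖w k.castSucc‖]
  have hexp : ∀ x : ℝ, 0 ≤ x → x ^ (2 / r) = (x ^ (1 / r)) ^ 2 := by
    intro x hx
    rw [← Real.rpow_natCast, ← Real.rpow_mul hx]
    congr 1
    push_cast
    ring
  rw [hexp _ (norm_nonneg _)] at hz' hw'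
  have h2 := two_mul_le_add_sq (‖z (Fin.last n)‖ ^ (1 / r)) (‖w (Fin.last n)‖ ^ (1 / r))
  rw [norm_mul, RCLike.norm_conj, Real.mul_rpow (norm_nonneg _) (norm_nonneg _)]
  linarith

/-- Dividing by (z w̄)^{p-1} is compensated by raising the exponent pα to p(α+1)-1, the index of the
factorial equal to Γ(p(α+1)). For p = 1 nothing is divided out, so zero is allowed. -/
theorem kernelTerm_factor {p : ℕ} (hp : 0 < p) (α : ℕ) {z w : ℂ}
    (h : 2 ≤ p → z * conj w ≠ 0) :
    ((Real.pi * p * Real.Gamma (p * (α + 1)) : ℝ) : ℂ)⁻¹ * ((z ^ p) ^ α * conj ((w ^ p) ^ α)) =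
      (Real.pi : ℂ)⁻¹ * (1 / ((p : ℂ) ^ 2 * (z * conj w) ^ (p - 1))) *
        ((z * conj w) ^ (p * (α + 1) - 1) / ((p * (α + 1) - 1).factorial : ℂ) * p) := by
  have hpos : 0 < p * (α + 1) := Nat.mul_pos hp (Nat.succ_pos α)
  have hG : Real.Gamma (p * (α + 1)) = ((p * (α + 1) - 1).factorial : ℝ) := by
    rw [← Real.Gamma_nat_eq_factorial]
    congr 1
    rw [Nat.cast_sub hpos]
    push_cast
    ring
  have hu : (z * conj w) ^ (p * (α + 1) - 1) = (z * conj w) ^ (p - 1) * ((z * conj w) ^ p) ^ α := by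
    rw [← pow_mul, ← pow_add]
    congr 1
    rw [mul_add, mul_one]
    omega
  have hne : (z * conj w) ^ (p - 1) ≠ 0 := by
    by_cases h2 : 2 ≤ p
    · exact pow_ne_zero _ (h h2)
    · rw [show p - 1 = 0 by omega, pow_zero]
      exact one_ne_zero
  have hp' : (p : ℂ) ≠ 0 := by exact_mod_cast hp.ne'
  have hf : ((p * (α + 1) - 1).factorial : ℂ) ≠ 0 := by exact_mod_cast Nat.factorial_ne_zero _
  have hpi : (Real.pi : ℂ) ≠ 0 := by exact_mod_cast Real.pi_ne_zero
  have hzw : (z ^ p) ^ α * conj ((w ^ p) ^ α) = ((z * conj w) ^ p) ^ α := by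
    simp only [map_pow, mul_pow]
  rw [hG, hu, hzw]
  push_cast
  field_simp

theorem kernelTerm_snoc_foldPoint (hp : ∀ k, 0 < p k) (hr : 0 < r) {z w : Fin (n + 1) → ℂ}
    (hne : ∀ k : Fin n, 2 ≤ p k → z k.castSucc * conj (w k.castSucc) ≠ 0)
    (α : Fin n → ℕ) (β : ℕ) :
    kernelTerm (Fin.snoc (α := fun _ => ℝ) (fun k : Fin n => (p k : ℝ)) r)
        (Fin.snoc (α := fun _ => ℕ) α β) (foldPoint p z) (foldPoint p w) =
      ((1 / ((r : ℂ) * (Real.pi : ℂ) ^ (n + 1))) *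
          (∏ k : Fin n,
            1 / ((p k : ℂ) ^ 2 * (z k.castSucc * conj (w k.castSucc)) ^ (p k - 1)))) *
        (z (Fin.last n) * conj (w (Fin.last n))) ^ β *
        (((Real.Gamma (r * (β + 1) + (n + 1 : ℕ) + (∑ k, (p k * (α k + 1) - 1) : ℕ)) /
          Real.Gamma (r * (β + 1)) : ℝ) : ℂ) *
          ∏ k : Fin n, ((z k.castSucc * conj (w k.castSucc)) ^ (p k * (α k + 1) - 1) /
            ((p k * (α k + 1) - 1).factorial : ℂ) * (p k : ℂ))) := by
  -- The n shifts p_k(α_k+1) = γ_k + 1, together with the leading 1, account for the derivative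
  -- order n + 1.
  have hA : 1 + (∑ k, (p k : ℝ) * (α k + 1) + r * (β + 1)) =
      r * (β + 1) + (n + 1 : ℕ) + (∑ k, (p k * (α k + 1) - 1) : ℕ) := by
    have : ∀ k, (((p k * (α k + 1) - 1 : ℕ)) : ℝ) = (p k : ℝ) * (α k + 1) - 1 := fun k => by
      rw [Nat.cast_sub (Nat.mul_pos (hp k) (Nat.succ_pos _))]
      push_cast
      ring
    rw [Nat.cast_sum]
    simp only [this, Finset.sum_sub_distrib]
    simp
    ring
  have hprod : (∏ k : Fin n, ((Real.pi * p k * Real.Gamma (p k * (α k + 1)) : ℝ) : ℂ))⁻¹ *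
      ((∏ k : Fin n, (z k.castSucc ^ p k) ^ α k) *
        conj (∏ k : Fin n, (w k.castSucc ^ p k) ^ α k)) =
      ((Real.pi : ℂ) ^ n)⁻¹ * (∏ k : Fin n,
            1 / ((p k : ℂ) ^ 2 * (z k.castSucc * conj (w k.castSucc)) ^ (p k - 1))) *
        ∏ k : Fin n, ((z k.castSucc * conj (w k.castSucc)) ^ (p k * (α k + 1) - 1) /
            ((p k * (α k + 1) - 1).factorial : ℂ) * (p k : ℂ)) := by
    have hpi : ((Real.pi : ℂ) ^ n)⁻¹ = ∏ _k : Fin n, (Real.pi : ℂ)⁻¹ := by simp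
    rw [hpi, map_prod, ← Finset.prod_inv_distrib, ← Finset.prod_mul_distrib,
      ← Finset.prod_mul_distrib, ← Finset.prod_mul_distrib, ← Finset.prod_mul_distrib]
    exact Finset.prod_congr rfl fun k _ => kernelTerm_factor (hp k) (α k) (hne k)
  have hr' : (r : ℂ) ≠ 0 := by exact_mod_cast hr.ne'
  have hpi : (Real.pi : ℂ) ≠ 0 := by exact_mod_cast Real.pi_ne_zero
  simp only [kernelTerm, monomialNormSq, foldPoint, Fin.prod_univ_castSucc, Fin.sum_univ_castSucc,
    Fin.snoc_castSucc, Fin.snoc_last, hA]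
  rw [Complex.ofReal_inv, Complex.ofReal_div, inv_div, Complex.ofReal_mul, Complex.ofReal_prod,
    Complex.ofReal_div, map_mul, map_pow, mul_pow]
  calc _ = ((∏ k : Fin n, ((Real.pi * p k * Real.Gamma (p k * (α k + 1)) : ℝ) : ℂ))⁻¹ *
      ((∏ k : Fin n, (z k.castSucc ^ p k) ^ α k) *
        conj (∏ k : Fin n, (w k.castSucc ^ p k) ^ α k))) *
        (((Real.Gamma (r * (β + 1) + (n + 1 : ℕ) + (∑ k, (p k * (α k + 1) - 1) : ℕ)) : ℝ) : ℂ) /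
          ((Real.pi * r * Real.Gamma (r * (β + 1)) : ℝ) : ℂ) *
          (z (Fin.last n) ^ β * conj (w (Fin.last n)) ^ β)) := by
        rw [div_eq_mul_inv, mul_inv, div_eq_mul_inv]
        ring
    _ = _ := by
        rw [hprod]
        push_cast
        rw [pow_succ]
        simp only [div_eq_mul_inv, mul_inv, one_mul]
        ring

theorem ellipsoidKernel_foldPoint (hp : ∀ k, 0 < p k) (hr : 0 < r) {ω : Fin n → ℂ}
    (hω : ∀ k, IsPrimitiveRoot (ω k) (p k)) {z w : Fin (n + 1) → ℂ}
    (hz : foldPoint p z ∈ generalDomain p r) (hw : foldPoint p w ∈ generalDomain p r)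
    (hne : ∀ k : Fin n, 2 ≤ p k → z k.castSucc * conj (w k.castSucc) ≠ 0) :
    ellipsoidKernel (Fin.snoc (α := fun _ => ℝ) (fun k : Fin n => (p k : ℝ)) r)
        (foldPoint p z) (foldPoint p w) =
      (1 / ((r : ℂ) * (Real.pi : ℂ) ^ (n + 1))) *
          (∏ k : Fin n,
            1 / ((p k : ℂ) ^ 2 * (z k.castSucc * conj (w k.castSucc)) ^ (p k - 1))) *
          ∑ j ∈ Fintype.piFinset (fun k : Fin n => Finset.Icc 1 (p k)),
            iteratedDeriv (n + 1)
              (fun t : ℂ => (∏ k : Fin n, conj (ω k) ^ j k) /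
                ((1 - t) ^ (r : ℂ) - z (Fin.last n) * conj (w (Fin.last n))))
              (∑ l : Fin n, z l.castSucc * conj (w l.castSucc) * conj (ω l) ^ j l) := by
  set Pf : ℂ := (1 / ((r : ℂ) * (Real.pi : ℂ) ^ (n + 1))) *
          (∏ k : Fin n,
            1 / ((p k : ℂ) ^ 2 * (z k.castSucc * conj (w k.castSucc)) ^ (p k - 1))) with hPf
  set u : Fin n → ℂ := fun k => z k.castSucc * conj (w k.castSucc) with hu
  set v : ℂ := z (Fin.last n) * conj (w (Fin.last n)) with hv
  set ξ : Fin n → ℂ := fun k => conj (ω k) with hξ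
  have hξp : ∀ k, IsPrimitiveRoot (ξ k) (p k) := fun k =>
    (hω k).map_of_injective (f := starRingEnd ℂ) (starRingEnd ℂ).injective
  set J := Fintype.piFinset (fun k : Fin n => Finset.Icc 1 (p k)) with hJ
  set T : (Fin n → ℕ) → ℂ := fun j => ∑ l, u l * ξ l ^ j l with hT
  have hlt : ∀ j, ‖T j‖ + ‖v‖ ^ (1 / r) < 1 := by
    intro j
    refine lt_of_le_of_lt (add_le_add_left (norm_sum_le_of_le _ fun l _ => ?_) _)
      (sum_norm_mul_add_lt_one hp hz hw)
    rw [norm_mul, norm_pow, (hξp l).norm'_eq_one (hp l).ne', one_pow, mul_one]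
  have hT1 : ∀ j, ‖T j‖ < 1 := fun j => by
    have := Real.rpow_nonneg (norm_nonneg v) (1 / r)
    linarith [hlt j]
  set c : ℕ → ℕ → ℝ := fun β m =>
    Real.Gamma (r * (β + 1) + (n + 1 : ℕ) + m) / Real.Gamma (r * (β + 1)) with hc
  set S : ℕ → ℂ := fun β => ∑ j ∈ J, (∏ k, ξ k ^ j k) *
    (((Real.Gamma (r * (β + 1) + (n + 1 : ℕ)) / Real.Gamma (r * (β + 1)) : ℝ) : ℂ) *
      (1 - T j) ^ (-((r * (β + 1) + (n + 1 : ℕ) : ℝ) : ℂ))) with hS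
  have hSsum : HasSum (fun β => Pf * (v ^ β * S β)) (Pf * ∑ j ∈ J, iteratedDeriv (n + 1)
      (fun t : ℂ => (∏ k : Fin n, ξ k ^ j k) / ((1 - t) ^ (r : ℂ) - v)) (T j)) := by
    refine HasSum.mul_left _ ?_
    simp only [hS, Finset.mul_sum]
    exact hasSum_sum fun j _ => hasSum_iteratedDeriv_inv_sub hr (hlt j) (n + 1) _
  set H : ℕ → (Fin n → ℕ) → ℂ := fun β γ => (c β (∑ k, γ k) : ℂ) *
    ∏ k, (u k ^ γ k / ((γ k).factorial : ℂ) * if p k ∣ γ k + 1 then (p k : ℂ) else 0) with hH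
  have hHsum : ∀ β, HasSum (fun m => ∑ γ ∈ Finset.piAntidiag Finset.univ m, H β γ) (S β) := by
    intro β
    have ha : 0 < r * (β + 1) + (n + 1 : ℕ) := by positivity
    have h1 : HasSum (fun m : ℕ => ∑ j ∈ J, (∏ k, ξ k ^ j k) *
        (((Real.Gamma (r * (β + 1) + (n + 1 : ℕ)) / Real.Gamma (r * (β + 1)) : ℝ) : ℂ) *
          (((Real.Gamma (r * (β + 1) + (n + 1 : ℕ) + m) / Real.Gamma (r * (β + 1) + (n + 1 : ℕ)) /
            m.factorial : ℝ) : ℂ) * T j ^ m))) (S β) :=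
      hasSum_sum fun j _ => ((hasSum_one_sub_cpow_neg ha (hT1 j)).mul_left _).mul_left _
    refine h1.congr_fun fun m => Eq.symm ?_
    have h2 : ∀ j, (∏ k, ξ k ^ j k) *
        (((Real.Gamma (r * (β + 1) + (n + 1 : ℕ)) / Real.Gamma (r * (β + 1)) : ℝ) : ℂ) *
          (((Real.Gamma (r * (β + 1) + (n + 1 : ℕ) + m) / Real.Gamma (r * (β + 1) + (n + 1 : ℕ)) /
            m.factorial : ℝ) : ℂ) * T j ^ m)) =
        ((c β m : ℂ) / m.factorial) * ((∏ k, ξ k ^ j k) * T j ^ m) := by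
      intro j
      have hG : ((Real.Gamma (r * (β + 1) + (n + 1 : ℕ)) : ℝ) : ℂ) ≠ 0 := by
        exact_mod_cast (Real.Gamma_pos_of_pos ha).ne'
      simp only [hc, Complex.ofReal_div, Complex.ofReal_natCast]
      field_simp
    simp only [h2]
    rw [← Finset.mul_sum, sum_prod_root_mul_sum_pow hξp, Finset.mul_sum]
    refine Finset.sum_congr rfl fun γ hγ => ?_
    have hm : (m.factorial : ℂ) ≠ 0 := by exact_mod_cast m.factorial_ne_zero
    simp only [hH, (Finset.mem_piAntidiag.1 hγ).1]
    field_simp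
  -- `φ` parametrizes the exponents that survive the filter; `H` vanishes off its range.
  let φ : (Fin n → ℕ) → Fin n → ℕ := fun α k => p k * (α k + 1) - 1
  have hφ : ∀ α k, φ α k + 1 = p k * (α k + 1) := fun α k =>
    Nat.sub_add_cancel (Nat.mul_pos (hp k) (Nat.succ_pos _))
  have hφinj : Function.Injective φ := by
    intro α α' h
    ext k
    have h1 : p k * (α k + 1) = p k * (α' k + 1) := by rw [← hφ, ← hφ, h]
    exact Nat.succ_injective (Nat.eq_of_mul_eq_mul_left (hp k) h1)
  have hrange : ∀ β, ∀ γ ∉ Set.range φ, Pf * (v ^ β * H β γ) = 0 := by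
    intro β γ hγ
    obtain ⟨k, hk⟩ : ∃ k, ¬ p k ∣ γ k + 1 := by
      by_contra! hall
      choose d hd using hall
      refine hγ ⟨fun k => d k - 1, funext fun k => ?_⟩
      have hdk : 0 < d k := Nat.pos_of_ne_zero fun h0 => by
        have := hd k
        rw [h0, mul_zero] at this
        exact Nat.succ_ne_zero _ this
      simp only [φ]
      rw [Nat.sub_add_cancel hdk, ← hd k, Nat.add_sub_cancel]
    have : ∏ k, (u k ^ γ k / ((γ k).factorial : ℂ) *
        if p k ∣ γ k + 1 then (p k : ℂ) else 0) = 0 :=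
      Finset.prod_eq_zero (Finset.mem_univ k) (by rw [if_neg hk, mul_zero])
    simp only [hH]
    rw [this]
    simp
  set q := Fin.snoc (α := fun _ => ℝ) (fun k : Fin n => (p k : ℝ)) r with hq
  have hterm : ∀ β α, kernelTerm q (Fin.snoc (α := fun _ => ℕ) α β) (foldPoint p z)
      (foldPoint p w) = Pf * (v ^ β * H β (φ α)) := by
    intro β α
    rw [hq, kernelTerm_snoc_foldPoint hp hr hne, mul_assoc]
    simp only [hH, hφ, dvd_mul_right, if_true]
    rfl
  rw [generalDomain_eq_powerEllipsoid] at hz hw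
  have hK := (summable_kernelTerm (snoc_cast_pos hp hr) hz hw).hasSum
  have hK' : HasSum (fun x : ℕ × (Fin n → ℕ) => Pf * (v ^ x.1 * H x.1 (φ x.2)))
      (ellipsoidKernel q (foldPoint p z) (foldPoint p w)) := by
    have h1 := (Fin.snocEquiv fun _ => ℕ).hasSum_iff.2 hK
    refine h1.congr_fun fun x => Eq.symm ?_
    exact hterm x.1 x.2
  -- `hHsum` only sums over γ grouped by degree. Unconditional summability comes from the kernel
  -- series, and regrouping that by degree identifies its value.
  have hfib : ∀ β, HasSum (fun α => Pf * (v ^ β * H β (φ α))) (Pf * (v ^ β * S β)) := by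
    intro β
    have h1 := (hK'.summable.prod_factor β).hasSum
    have h2 := ((hφinj.hasSum_iff (hrange β)).1 h1).sum_piAntidiag
    simp only [← Finset.mul_sum] at h2
    rw [h2.unique (((hHsum β).mul_left (v ^ β)).mul_left Pf)] at h1
    exact h1
  exact (hK'.prod_fiberwise hfib).unique hSsum

end

theorem mainTheorem3 (n : ℕ) (p : Fin n → ℕ) (hp : ∀ k, 0 < p k) (r : ℝ) (hr : 0 < r) :
    (∃ K, IsBergmanKernel (generalDomain p r) K) ∧
    ∀ K, IsBergmanKernel (generalDomain p r) K →
      ∀ ω : Fin n → ℂ, (∀ k, IsPrimitiveRoot (ω k) (p k)) →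
      ∀ z w : Fin (n + 1) → ℂ,
        foldPoint p z ∈ generalDomain p r → foldPoint p w ∈ generalDomain p r →
        (∀ k : Fin n, 2 ≤ p k → z k.castSucc * conj (w k.castSucc) ≠ 0) →
        K (foldPoint p z) (foldPoint p w) =
          (1 / ((r : ℂ) * (Real.pi : ℂ) ^ (n + 1))) *
          (∏ k : Fin n,
            1 / ((p k : ℂ) ^ 2 * (z k.castSucc * conj (w k.castSucc)) ^ (p k - 1))) *
          ∑ j ∈ Fintype.piFinset (fun k : Fin n => Finset.Icc 1 (p k)),
            iteratedDeriv (n + 1)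
              (fun t : ℂ => (∏ k : Fin n, conj (ω k) ^ j k) /
                ((1 - t) ^ (r : ℂ) - z (Fin.last n) * conj (w (Fin.last n))))
              (∑ l : Fin n, z l.castSucc * conj (w l.castSucc) * conj (ω l) ^ j l) := by
  have hq := snoc_cast_pos hp hr
  have hker := isBergmanKernel_ellipsoidKernel hq
  have hopen := isOpen_powerEllipsoid hq
  rw [← generalDomain_eq_powerEllipsoid] at hker hopen
  refine ⟨⟨_, hker⟩, fun K hK ω hω z w hz hw hne => ?_⟩
  rw [hK.eq_of_mem hopen hker hz hw]
  exact ellipsoidKernel_foldPoint hp hr hω hz hw hne
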